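/- A binary code of length $n$ is a linear subspace $C\subseteq\mathbb F_2^n$; it is self-dual if $C=C^\perp$, and an $[n,k,d]$ code if it has dimension $k$ and minimum nonzero weight $d$. A self-dual code $C$ is singly even if it has a codeword of weight $\equiv 2 \pmod 4$; its shadow is then $S=C_0^\perp\setminus C$, where $C_0$ is the subcode of codewords of weight divisible by $4$. For $n\equiv 4\pmod 8$, $C$ is said to have minimal shadow if the minimum weight of $S$ is $2$. The weight enumerator of $T\subseteq\mathbb F_2^n$ is $\sum_{x\in T}y^{\mathrm{wt}(x)}$. **Theorem.** Let $m\ge 1$. (a) There is exactly one pair $(W,S)$ of polynomials in $\mathbb Q[y]$ of the form $$W=\sum_{i=0}^{12m+2}a_iy^{2i}=\sum_{j=0}^{3m}c_j(1+y^2)^{12m+2-4j}\bigl(y^2(1-y^2)^2\bigr)^j,$$ $$S=\sum_{i=0}^{6m}b_iy^{4i+2}=\sum_{j=0}^{3m}(-1)^jc_j2^{12m+2-6j}y^{12m+2-4j}(1-y^4)^{2j}$$ with common $c_0,\dots,c_{3m}\in\mathbb Q$, such that $a_0=1$, $a_1=\dots=a_{2m}=0$, $b_0=1$ and $b_1=\dots=b_{m-1}=0$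 (the last condition being empty for $m=1$). For every singly even self-dual $[24m+4,12m+2,4m+2]$ code with minimal shadow, the weight enumerator of the code is $W$ and the weight enumerator of its shadow is $S$. (b) All coefficients of $W$ and $S$ are nonnegative integers if and only if $m\le 155$. (c) Consequently, if $m\ge 156$, there is no singly even self-dual $[24m+4,12m+2,4m+2]$ code with minimal shadow. -/

import Mathlib

open Polynomial

/-- The dual of a set `T` of binary vectors: all `x` with `x ⬝ y = 0` for every `y ∈ T`. -/
def dualCode {n : ℕ} (T : Set (Fin n → ZMod 2)) : Submodule (ZMod 2) (Fin n → ZMod 2) where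
  carrier := {x | ∀ y ∈ T, x ⬝ᵥ y = 0}
  add_mem' := by
    intro a b ha hb y hy
    rw [add_dotProduct, ha y hy, hb y hy, add_zero]
  zero_mem' := by
    intro y _
    exact zero_dotProduct y
  smul_mem' := by
    intro c x hx y hy
    rw [smul_dotProduct, hx y hy, smul_zero]

/-- `C = C^⊥`. -/
def IsSelfDualCode {n : ℕ} (C : Submodule (ZMod 2) (Fin n → ZMod 2)) : Prop :=
  C = dualCode (C : Set (Fin n → ZMod 2))

/-- A self-dual code with at least one codeword of weight `≡ 2 (mod 4)`. -/
def IsSinglyEvenSelfDual {n : ℕ} (C : Submodule (ZMod 2) (Fin n → ZMod 2)) : Prop :=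
  IsSelfDualCode C ∧ ∃ x ∈ C, hammingNorm x % 4 = 2

/-- The subcode `C₀` of codewords of weight `≡ 0 (mod 4)`. -/
def doublyEvenPart {n : ℕ} (C : Submodule (ZMod 2) (Fin n → ZMod 2)) :
    Set (Fin n → ZMod 2) :=
  {x | x ∈ C ∧ hammingNorm x % 4 = 0}

/-- The shadow `S = C₀^⊥ \ C`. -/
def shadow {n : ℕ} (C : Submodule (ZMod 2) (Fin n → ZMod 2)) : Set (Fin n → ZMod 2) :=
  (dualCode (doublyEvenPart C) : Set (Fin n → ZMod 2)) \ (C : Set (Fin n → ZMod 2))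

/-- `d` is the minimum weight of the nonzero vectors of `T`. -/
def IsMinWeight {n : ℕ} (T : Set (Fin n → ZMod 2)) (d : ℕ) : Prop :=
  IsLeast {w : ℕ | ∃ x ∈ T, x ≠ 0 ∧ hammingNorm x = w} d

/-- `C` is an `[n, k, d]` code. -/
def IsCodeWithParams {n : ℕ} (C : Submodule (ZMod 2) (Fin n → ZMod 2)) (k d : ℕ) : Prop :=
  Module.finrank (ZMod 2) C = k ∧ IsMinWeight (C : Set (Fin n → ZMod 2)) d

/-- The number `r`, equal to `4, 1, 2, 3` for `n ≡ 0, 2, 4, 6 (mod 8)`. (Self-dual codes have even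
length, so odd `n` do not matter.) -/
def minimalShadowWeight (n : ℕ) : ℕ :=
  if n % 8 = 0 then 4 else (n % 8) / 2

/-- `C` is a code with minimal shadow: the minimum weight of its shadow is `r`. -/
def HasMinimalShadow {n : ℕ} (C : Submodule (ZMod 2) (Fin n → ZMod 2)) : Prop :=
  IsMinWeight (shadow C) (minimalShadowWeight n)

/-- `C` is a singly even self-dual `[24m+4, 12m+2, 4m+2]` code with minimal shadow. -/
def IsMinimalShadowCode (m : ℕ) (C : Submodule (ZMod 2) (Fin (24 * m + 4) → ZMod 2)) : Prop :=
  IsSinglyEvenSelfDual C ∧ IsCodeWithParams C (12 * m + 2) (4 * m + 2) ∧ HasMinimalShadow C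

open Classical in
/-- The weight enumerator `∑_{x ∈ T} y^{wt(x)}`, as a polynomial with rational coefficients. -/
noncomputable def weightEnumerator {n : ℕ} (T : Set (Fin n → ZMod 2)) : ℚ[X] :=
  ∑ x : Fin n → ZMod 2 with x ∈ T, X ^ hammingNorm x

/-- `∑_{j=0}^{⌊n/8⌋} c_j (1+y²)^{n/2-4j} (y²(1-y²)²)^j`. -/
noncomputable def codeForm (n : ℕ) (c : ℕ → ℚ) : ℚ[X] :=
  ∑ j ∈ Finset.range (n / 8 + 1),
    C (c j) * (1 + X ^ 2) ^ (n / 2 - 4 * j) * (X ^ 2 * (1 - X ^ 2) ^ 2) ^ j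

/-- `∑_{j=0}^{⌊n/8⌋} (-1)^j c_j 2^{n/2-6j} y^{n/2-4j} (1-y⁴)^{2j}`; the exponent of `2` may be
negative. -/
noncomputable def shadowForm (n : ℕ) (c : ℕ → ℚ) : ℚ[X] :=
  ∑ j ∈ Finset.range (n / 8 + 1),
    C ((-1) ^ j * c j * (2 : ℚ) ^ (((n / 2 : ℕ) : ℤ) - 6 * (j : ℤ))) *
      X ^ (n / 2 - 4 * j) * (1 - X ^ 4) ^ (2 * j)

/-- `(W, S) = (∑ a_i y^{2i}, ∑ b_i y^{4i+2})` is a candidate for the weight enumerators of a singly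
even self-dual `[24m+4, 12m+2, 4m+2]` code with minimal shadow and of its shadow: both have the form
of the weight enumerators of a singly even self-dual code of length `24m+4` and of its shadow, with
the same `c_j`, and `a_0 = 1`, `a_1 = ⋯ = a_{2m} = 0`, `b_0 = 1`, `b_1 = ⋯ = b_{m-1} = 0`. -/
def IsEnumeratorPair (m : ℕ) (W S : ℚ[X]) : Prop :=
  (∃ c : ℕ → ℚ, W = codeForm (24 * m + 4) c ∧ S = shadowForm (24 * m + 4) c) ∧
  W.coeff 0 = 1 ∧ (∀ i : ℕ, 1 ≤ i → i ≤ 2 * m → W.coeff (2 * i) = 0) ∧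
  S.coeff 2 = 1 ∧ (∀ i : ℕ, 1 ≤ i → i < m → S.coeff (4 * i + 2) = 0)

/-- All coefficients of `P` are nonnegative integers. -/
def HasNonnegIntCoeffs (P : ℚ[X]) : Prop :=
  ∀ i : ℕ, ∃ k : ℕ, P.coeff i = (k : ℚ)

/-! With t = y^2 and u = y^4, the j-th term of W is divisible by t^j. The term of S with index k =
3m - j is, apart from the factor y^2, divisible by u^k. So a_0, ..., a_{2m} determine c_0, ...,
c_{2m}, and b_0, ..., b_{m-1} determine c_{3m}, ..., c_{2m+1}, triangularly from the two ends. These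
are 3m+1 conditions on 3m+1 unknowns, hence a unique pair.

A code yields such a pair. The MacWilliams identity and Gleason's theorem (`exists_eq_codeForm`)
give the form of W. The shadow consists of the v whose character u ↦ (-1)^(u·v) on C is (-1)^(wt u /
2) (`IsSinglyEvenSelfDual.mem_shadow_iff`), so the signed MacWilliams transform gives S with the
same c_j. If s is a shadow vector of weight 2 and v is another shadow vector, then v + s is a
nonzero codeword, so wt v ≥ 4m. This gives the conditions on the b_i
(`IsMinimalShadowCode.isEnumeratorPair`).

For m ≥ 175, Lagrange inversion gives c_{2m} and c_{2m-1} as sums of binomials, hence a closed form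
for b_{m+1}. There the negative contribution -16 m c_{2m} outgrows the positive one -256 c_{2m-1},
and b_{m+1} < 0. For m < 175 the pair is computed exactly: W at t = -2^k and S at u = 2^k are single
integers whose base 2^k digits encode all coefficients. For m ≤ 155 all are nonnegative; for 156 ≤ m
< 175, a_{2m+4} < 0. Part (c) follows because weight enumerators count vectors. -/

/-! ### Passage to the variables t = y^2 and u = y^4. -/

/-- The polynomial in `t = y ^ 2` underlying `codeForm (24 * m + 4) c`. -/
noncomputable def codePoly (m : ℕ) (c : ℕ → ℚ) : ℚ[X] :=
  ∑ j ∈ Finset.range (3 * m + 1),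
    C (c j) * (1 + X) ^ (12 * m + 2 - 4 * j) * (X * (1 - X) ^ 2) ^ j

/-- The polynomial in `u = y ^ 4` underlying the shadow form. -/
noncomputable def shadowPoly (m : ℕ) (d : ℕ → ℚ) : ℚ[X] :=
  ∑ k ∈ Finset.range (3 * m + 1), C (d k) * X ^ k * (1 - X) ^ (6 * m - 2 * k)

/-- The coefficients of the shadow form with respect to `u ^ k * (1 - u) ^ (6 * m - 2 * k)`. -/
noncomputable def shadowCoeff (m : ℕ) (c : ℕ → ℚ) (k : ℕ) : ℚ :=
  (-1) ^ (3 * m - k) * c (3 * m - k) * (2 : ℚ) ^ ((2 : ℤ) + 6 * k - 6 * m)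

theorem codeForm_eq_expand (m : ℕ) (c : ℕ → ℚ) :
    codeForm (24 * m + 4) c = expand ℚ 2 (codePoly m c) := by
  have h1 : (24 * m + 4) / 8 = 3 * m := by omega
  have h2 : (24 * m + 4) / 2 = 12 * m + 2 := by omega
  simp [codeForm, codePoly, h1, h2, map_sum]

theorem shadowForm_eq_expand (m : ℕ) (c : ℕ → ℚ) :
    shadowForm (24 * m + 4) c = X ^ 2 * expand ℚ 4 (shadowPoly m (shadowCoeff m c)) := by
  have h1 : (24 * m + 4) / 8 = 3 * m := by omega
  have h2 : (24 * m + 4) / 2 = 12 * m + 2 := by omega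
  rw [shadowForm, h1, h2, ← Finset.sum_range_reflect, shadowPoly, map_sum, Finset.mul_sum]
  refine Finset.sum_congr rfl fun k hk => ?_
  have hk : k ≤ 3 * m := by simpa [Nat.lt_succ_iff] using hk
  have e1 : 3 * m + 1 - 1 - k = 3 * m - k := by omega
  have e2 : 12 * m + 2 - 4 * (3 * m - k) = 2 + 4 * k := by omega
  have e3 : 2 * (3 * m - k) = 6 * m - 2 * k := by omega
  have e4 : (((12 * m + 2 : ℕ) : ℤ) - 6 * ((3 * m - k : ℕ) : ℤ)) = (2 : ℤ) + 6 * k - 6 * m := by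
    omega
  rw [e1, e2, e3, e4]
  simp only [shadowCoeff, map_mul, map_pow, expand_C, expand_X, map_sub, map_one]
  ring

theorem coeff_expand_two_mul (P : ℚ[X]) (i : ℕ) : (expand ℚ 2 P).coeff (2 * i) = P.coeff i := by
  rw [mul_comm, coeff_expand_mul (by norm_num)]

theorem coeff_shadow_expand (P : ℚ[X]) (i : ℕ) :
    (X ^ 2 * expand ℚ 4 P).coeff (4 * i + 2) = P.coeff i := by
  rw [coeff_X_pow_mul, mul_comm, coeff_expand_mul (by norm_num)]

/-- The coefficient conditions of `IsEnumeratorPair` in terms of the underlying polynomials. -/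
def IsEnumeratorSeq (m : ℕ) (c : ℕ → ℚ) : Prop :=
  (codePoly m c).coeff 0 = 1 ∧ (∀ i, 1 ≤ i → i ≤ 2 * m → (codePoly m c).coeff i = 0) ∧
  (shadowPoly m (shadowCoeff m c)).coeff 0 = 1 ∧
  ∀ i, 1 ≤ i → i < m → (shadowPoly m (shadowCoeff m c)).coeff i = 0

theorem isEnumeratorPair_iff (m : ℕ) (W S : ℚ[X]) :
    IsEnumeratorPair m W S ↔ ∃ c, W = expand ℚ 2 (codePoly m c) ∧
      S = X ^ 2 * expand ℚ 4 (shadowPoly m (shadowCoeff m c)) ∧ IsEnumeratorSeq m c := by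
  have key : ∀ c, (((expand ℚ 2 (codePoly m c)).coeff 0 = 1 ∧
      (∀ i : ℕ, 1 ≤ i → i ≤ 2 * m → (expand ℚ 2 (codePoly m c)).coeff (2 * i) = 0) ∧
      (X ^ 2 * expand ℚ 4 (shadowPoly m (shadowCoeff m c))).coeff 2 = 1 ∧
      (∀ i : ℕ, 1 ≤ i → i < m →
        (X ^ 2 * expand ℚ 4 (shadowPoly m (shadowCoeff m c))).coeff (4 * i + 2) = 0)) ↔
      IsEnumeratorSeq m c) := by
    intro c
    have h0 := coeff_expand_two_mul (codePoly m c) 0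
    have h2 := coeff_shadow_expand (shadowPoly m (shadowCoeff m c)) 0
    rw [mul_zero] at h0
    rw [mul_zero, zero_add] at h2
    simp only [coeff_expand_two_mul, coeff_shadow_expand, IsEnumeratorSeq, h0, h2]
  constructor
  · rintro ⟨⟨c, rfl, rfl⟩, h⟩
    rw [codeForm_eq_expand, shadowForm_eq_expand] at h
    exact ⟨c, codeForm_eq_expand m c, shadowForm_eq_expand m c, (key c).1 h⟩
  · rintro ⟨c, rfl, rfl, h⟩
    exact ⟨⟨c, (codeForm_eq_expand m c).symm, (shadowForm_eq_expand m c).symm⟩, (key c).2 h⟩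

/-! ### Existence and uniqueness of the pair by triangularity. -/

theorem coeff_triangular_sum {L i : ℕ} (hi : i < L) (c : ℕ → ℚ) (U : ℕ → ℚ[X])
    (hU : (U i).coeff 0 = 1) (hc : ∀ j < i, c j = 0) :
    (∑ j ∈ Finset.range L, C (c j) * X ^ j * U j).coeff i = c i := by
  rw [finsetSum_coeff, Finset.sum_eq_single i]
  · rw [mul_assoc, coeff_C_mul, coeff_X_pow_mul', if_pos le_rfl, Nat.sub_self, hU, mul_one]
  · intro j _ hji
    rcases lt_or_gt_of_ne hji with h | h
    · simp [hc j h]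
    · rw [mul_assoc, coeff_C_mul, coeff_X_pow_mul', if_neg (by omega), mul_zero]
  · intro h; exact absurd (Finset.mem_range.2 hi) h

theorem codePoly_coeff_of_lt {m i : ℕ} (hi : i ≤ 3 * m) (c : ℕ → ℚ) (hc : ∀ j < i, c j = 0) :
    (codePoly m c).coeff i = c i := by
  rw [← coeff_triangular_sum (Nat.lt_succ_of_le hi) c
    (fun j => (1 + X) ^ (12 * m + 2 - 4 * j) * (1 - X) ^ (2 * j)) _ hc, codePoly]
  · congr 1
    refine Finset.sum_congr rfl fun j _ => ?_
    rw [mul_pow, ← pow_mul]; ring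
  · simp [coeff_zero_eq_eval_zero]

theorem shadowPoly_coeff_of_lt {m i : ℕ} (hi : i ≤ 3 * m) (d : ℕ → ℚ) (hd : ∀ j < i, d j = 0) :
    (shadowPoly m d).coeff i = d i :=
  coeff_triangular_sum (Nat.lt_succ_of_le hi) d (fun k => (1 - X) ^ (6 * m - 2 * k))
    (by simp [coeff_zero_eq_eval_zero]) hd

theorem codePoly_congr {m : ℕ} {c c' : ℕ → ℚ} (h : ∀ j ≤ 3 * m, c j = c' j) :
    codePoly m c = codePoly m c' :=
  Finset.sum_congr rfl fun j hj => by rw [h j (Nat.lt_succ_iff.1 (Finset.mem_range.1 hj))]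

theorem shadowPoly_congr {m : ℕ} {c c' : ℕ → ℚ} (h : ∀ j ≤ 3 * m, c j = c' j) :
    shadowPoly m c = shadowPoly m c' :=
  Finset.sum_congr rfl fun j hj => by rw [h j (Nat.lt_succ_iff.1 (Finset.mem_range.1 hj))]

theorem shadowCoeff_congr {m : ℕ} {c c' : ℕ → ℚ} (h : ∀ j ≤ 3 * m, c j = c' j) (k : ℕ) :
    shadowCoeff m c k = shadowCoeff m c' k := by
  rw [shadowCoeff, shadowCoeff, h _ (Nat.sub_le _ _)]

theorem codePoly_add (m : ℕ) (c c' : ℕ → ℚ) :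
    codePoly m (c + c') = codePoly m c + codePoly m c' := by
  simp [codePoly, ← Finset.sum_add_distrib, add_mul]

theorem codePoly_smul (m : ℕ) (r : ℚ) (c : ℕ → ℚ) :
    codePoly m (r • c) = r • codePoly m c := by
  simp [codePoly, Finset.smul_sum, smul_eq_C_mul, mul_assoc]

theorem shadowPoly_add (m : ℕ) (c c' : ℕ → ℚ) :
    shadowPoly m (c + c') = shadowPoly m c + shadowPoly m c' := by
  simp [shadowPoly, ← Finset.sum_add_distrib, add_mul]

theorem shadowPoly_smul (m : ℕ) (r : ℚ) (c : ℕ → ℚ) :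
    shadowPoly m (r • c) = r • shadowPoly m c := by
  simp [shadowPoly, Finset.smul_sum, smul_eq_C_mul, mul_assoc]

theorem shadowCoeff_add (m : ℕ) (c c' : ℕ → ℚ) :
    shadowCoeff m (c + c') = shadowCoeff m c + shadowCoeff m c' := by
  ext k; simp only [shadowCoeff, Pi.add_apply]; ring

theorem shadowCoeff_smul (m : ℕ) (r : ℚ) (c : ℕ → ℚ) :
    shadowCoeff m (r • c) = r • shadowCoeff m c := by
  ext k; simp only [shadowCoeff, Pi.smul_apply, smul_eq_mul]; ring

/-- Extension of a finite sequence by zero. -/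
def extendZero {L : ℕ} : (Fin L → ℚ) →ₗ[ℚ] (ℕ → ℚ) where
  toFun c j := if h : j < L then c ⟨j, h⟩ else 0
  map_add' c c' := by ext j; by_cases h : j < L <;> simp [h]
  map_smul' r c := by ext j; by_cases h : j < L <;> simp [h]

/-- The prescribed coefficients `a_0, …, a_{2m}, b_{m-1}, …, b_0` as a linear function of the
sequence `c_0, …, c_{3m}`. -/
noncomputable def prescribedCoeffs (m : ℕ) : (Fin (3 * m + 1) → ℚ) →ₗ[ℚ] (Fin (3 * m + 1) → ℚ) where
  toFun c i := if (i : ℕ) ≤ 2 * m then (codePoly m (extendZero c)).coeff i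
    else (shadowPoly m (shadowCoeff m (extendZero c))).coeff (3 * m - i)
  map_add' c c' := by
    ext i
    by_cases h : (i : ℕ) ≤ 2 * m <;>
      simp [h, codePoly_add, shadowCoeff_add, shadowPoly_add]
  map_smul' r c := by
    ext i
    by_cases h : (i : ℕ) ≤ 2 * m <;>
      simp [h, codePoly_smul, shadowCoeff_smul, shadowPoly_smul]

/-- Vanishing a_0, ..., a_{2m} kill c_0, ..., c_{2m} one after another. Vanishing b_0, ..., b_{m-1}
kill the shadow coefficients d_0, ..., d_{m-1}, which are nonzero multiples of c_{3m}, ...,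
c_{2m+1}. -/
theorem prescribedCoeffs_injective (m : ℕ) : Function.Injective (prescribedCoeffs m) := by
  rw [← LinearMap.ker_eq_bot, LinearMap.ker_eq_bot']
  intro c hc
  have hci : ∀ i : ℕ, ∀ h : i < 3 * m + 1, (if i ≤ 2 * m then (codePoly m (extendZero c)).coeff i
    else (shadowPoly m (shadowCoeff m (extendZero c))).coeff (3 * m - i)) = 0 :=
    fun i h => congrFun hc ⟨i, h⟩
  have h1 : ∀ i, i ≤ 2 * m → extendZero c i = 0 := by
    intro i
    induction i using Nat.strong_induction_on with
    | _ i ih =>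
      intro hi
      rw [← codePoly_coeff_of_lt (m := m) (by omega) _ fun j hj => ih j hj (by omega)]
      simpa [hi] using hci i (by omega)
  have h2 : ∀ k, k < m → shadowCoeff m (extendZero c) k = 0 := by
    intro k
    induction k using Nat.strong_induction_on with
    | _ k ih =>
      intro hk
      rw [← shadowPoly_coeff_of_lt (m := m) (by omega) _ fun j hj => ih j hj (by omega)]
      have := hci (3 * m - k) (by omega)
      rwa [if_neg (by omega), show 3 * m - (3 * m - k) = k by omega] at this
  ext ⟨i, hi⟩
  have : extendZero c i = c ⟨i, hi⟩ := dif_pos hi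
  rw [← this, Pi.zero_apply]
  by_cases h : i ≤ 2 * m
  · exact h1 i h
  · have h3 := h2 (3 * m - i) (by omega)
    rw [shadowCoeff, show 3 * m - (3 * m - i) = i by omega] at h3
    have h4 : (2 : ℚ) ^ ((2 : ℤ) + 6 * ((3 * m - i : ℕ) : ℤ) - 6 * m) ≠ 0 :=
      zpow_ne_zero _ two_ne_zero
    simpa [h4] using h3

theorem exists_isEnumeratorSeq {m : ℕ} (hm : 1 ≤ m) : ∃ c, IsEnumeratorSeq m c := by
  obtain ⟨c, hc⟩ := (LinearMap.injective_iff_surjective.1 (prescribedCoeffs_injective m))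
    -- Index 0 carries a_0 and index 3m carries b_0; since m ≥ 1, index 3m lies in the shadow
    -- branch.
    fun i => if (i : ℕ) = 0 ∨ (i : ℕ) = 3 * m then 1 else 0
  have hci : ∀ i : ℕ, ∀ h : i < 3 * m + 1, (if i ≤ 2 * m then (codePoly m (extendZero c)).coeff i
    else (shadowPoly m (shadowCoeff m (extendZero c))).coeff (3 * m - i)) =
      if i = 0 ∨ i = 3 * m then 1 else 0 :=
    fun i h => congrFun hc ⟨i, h⟩
  refine ⟨extendZero c, by simpa using hci 0 (by omega), fun i h1 h2 => ?_, ?_, fun i h1 h2 => ?_⟩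
  · have := hci i (by omega)
    rwa [if_pos h2, if_neg (by omega)] at this
  · have := hci (3 * m) (by omega)
    rwa [if_neg (by omega), if_pos (by omega), Nat.sub_self] at this
  · have := hci (3 * m - i) (by omega)
    rwa [if_neg (by omega), if_neg (by omega), show 3 * m - (3 * m - i) = i by omega] at this

theorem IsEnumeratorSeq.eq {m : ℕ} {c c' : ℕ → ℚ} (h : IsEnumeratorSeq m c)
    (h' : IsEnumeratorSeq m c') : ∀ j ≤ 3 * m, c j = c' j := by
  have ext_eq : ∀ c : ℕ → ℚ, ∀ j ≤ 3 * m,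
      extendZero (fun j : Fin (3 * m + 1) => c j) j = c j := by
    intro c j hj
    exact dif_pos (Nat.lt_succ_of_le hj)
  have key : prescribedCoeffs m (fun j => c j) = prescribedCoeffs m (fun j => c' j) := by
    ext ⟨i, hi⟩
    simp only [prescribedCoeffs, LinearMap.coe_mk, AddHom.coe_mk]
    rw [codePoly_congr (ext_eq c), codePoly_congr (ext_eq c'),
      shadowPoly_congr fun k _ => shadowCoeff_congr (ext_eq c) k,
      shadowPoly_congr fun k _ => shadowCoeff_congr (ext_eq c') k]
    obtain ⟨a0, a, b0, b⟩ := h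
    obtain ⟨a0', a', b0', b'⟩ := h'
    split_ifs with h
    · rcases Nat.eq_zero_or_pos i with rfl | hi0
      · rw [a0, a0']
      · rw [a i hi0 h, a' i hi0 h]
    · rcases Nat.eq_zero_or_pos (3 * m - i) with h0 | hi0
      · rw [h0, b0, b0']
      · rw [b _ hi0 (by omega), b' _ hi0 (by omega)]
  intro j hj
  exact congrFun (prescribedCoeffs_injective m key) ⟨j, Nat.lt_succ_of_le hj⟩

theorem isEnumeratorPair_unique {m : ℕ} {W S W' S' : ℚ[X]} (h : IsEnumeratorPair m W S)
    (h' : IsEnumeratorPair m W' S') : W' = W ∧ S' = S := by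
  obtain ⟨c, rfl, rfl, hc⟩ := (isEnumeratorPair_iff m W S).1 h
  obtain ⟨c', rfl, rfl, hc'⟩ := (isEnumeratorPair_iff m W' S').1 h'
  rw [codePoly_congr (hc'.eq hc), shadowPoly_congr fun k _ => shadowCoeff_congr (hc'.eq hc) k]
  exact ⟨rfl, rfl⟩

/-! ### Gleason's theorem for lengths 4 mod 8. -/

theorem macWilliams_poly {n : ℕ} {r : ℚ} {P : ℚ[X]} (hdeg : P.natDegree ≤ n)
    (hinv : ∀ y : ℚ, 1 < y → (1 + y) ^ n * P.eval ((1 - y) / (1 + y)) = r * P.eval y) :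
    C r * P = ∑ i ∈ Finset.range (n + 1), C (P.coeff i) * (1 + X) ^ (n - i) * (1 - X) ^ i := by
  refine eq_of_infinite_eval_eq _ _ ((Set.Ioi_infinite (1 : ℚ)).mono fun y hy => ?_)
  have hy : 1 < y := hy
  have h1 : (1 + y) ≠ 0 := by linarith
  rw [Set.mem_ofPred_eq, eval_mul, eval_C, ← hinv y hy,
    eval_eq_sum_range' (Nat.lt_succ_of_le hdeg), Finset.mul_sum, eval_finsetSum]
  refine Finset.sum_congr rfl fun i hi => ?_
  have hi : i ≤ n := Nat.lt_succ_iff.1 (Finset.mem_range.1 hi)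
  simp only [eval_mul, eval_C, eval_pow, eval_add, eval_one, eval_X, eval_sub]
  rw [div_pow, show (1 + y) ^ n = (1 + y) ^ (n - i) * (1 + y) ^ i by
    rw [← pow_add, Nat.sub_add_cancel hi]]
  field_simp

/-- The polynomial `y ^ 2 * (1 - y ^ 2) ^ 2`. -/
noncomputable def gleasonFactor : ℚ[X] := X ^ 2 * (1 - X ^ 2) ^ 2

/-- The value at 0 of the MacWilliams identity says that the coefficients of P sum to r P(0) = 0.
For even i the product (1+X)^(n-i) (1-X)^i is monic of degree n, so the top coefficient of the
identity equates r times the leading coefficient with that same sum. -/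
theorem coeff_extreme_eq_zero {n : ℕ} {r : ℚ} (hr : r ≠ 0) {P : ℚ[X]}
    (hdeg : P.natDegree ≤ n) (hodd : ∀ i, Odd i → P.coeff i = 0)
    (hinv : ∀ y : ℚ, 1 < y → (1 + y) ^ n * P.eval ((1 - y) / (1 + y)) = r * P.eval y)
    (h0 : P.coeff 0 = 0) : P.coeff n = 0 := by
  have h := macWilliams_poly hdeg hinv
  have h1 : ∑ i ∈ Finset.range (n + 1), P.coeff i = 0 := by
    have := congrArg (eval 0) h
    rw [eval_mul, ← coeff_zero_eq_eval_zero P, h0, mul_zero, eval_finsetSum] at this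
    simpa using this.symm
  have h2 := congrArg (fun Q => Q.coeff n) h
  simp only [coeff_C_mul, finsetSum_coeff, mul_assoc] at h2
  have h3 : ∀ i ∈ Finset.range (n + 1),
      P.coeff i * ((1 + X : ℚ[X]) ^ (n - i) * (1 - X) ^ i).coeff n = P.coeff i := by
    intro i hi
    have hi : i ≤ n := Nat.lt_succ_iff.1 (Finset.mem_range.1 hi)
    rcases Nat.even_or_odd i with he | ho
    · have e1 : (1 + X : ℚ[X]).natDegree = 1 := by
        rw [add_comm]; exact natDegree_X_add_C (1 : ℚ)
      have e2 : (1 + X : ℚ[X]).Monic := by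
        rw [add_comm]; exact monic_X_add_C (1 : ℚ)
      have e3 : (X - 1 : ℚ[X]).natDegree = 1 := natDegree_X_sub_C (1 : ℚ)
      have e4 : (X - 1 : ℚ[X]).Monic := monic_X_sub_C (1 : ℚ)
      have e5 : (1 - X : ℚ[X]) ^ i = (X - 1) ^ i := by
        rw [← neg_sub, he.neg_pow]
      have e6 : ((1 + X : ℚ[X]) ^ (n - i) * (X - 1) ^ i).Monic := (e2.pow _).mul (e4.pow _)
      have e7 : ((1 + X : ℚ[X]) ^ (n - i) * (X - 1) ^ i).natDegree = n := by
        rw [(e2.pow _).natDegree_mul (e4.pow _), e2.natDegree_pow, e4.natDegree_pow, e1, e3]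
        omega
      have e8 := e6.coeff_natDegree
      rw [e7] at e8
      rw [e5, e8, mul_one]
    · rw [hodd i ho, zero_mul]
  rw [Finset.sum_congr rfl h3, h1] at h2
  exact (mul_eq_zero.1 h2).resolve_left hr

/-- Only even i with 2 ≤ i ≤ n - 2 contribute to the MacWilliams expansion, and each such term
contains (1+X)^2 (1-X)^2. -/
theorem gleasonFactor_dvd {n : ℕ} (hn : Even n) {r : ℚ} (hr : r ≠ 0) {P : ℚ[X]}
    (hdeg : P.natDegree ≤ n) (hodd : ∀ i, Odd i → P.coeff i = 0)
    (hinv : ∀ y : ℚ, 1 < y → (1 + y) ^ n * P.eval ((1 - y) / (1 + y)) = r * P.eval y)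
    (h0 : P.coeff 0 = 0) : gleasonFactor ∣ P := by
  have hn0 := coeff_extreme_eq_zero hr hdeg hodd hinv h0
  refine IsCoprime.mul_dvd ?_ ?_ ?_
  · exact IsCoprime.pow ⟨X, 1, by ring⟩
  · rw [X_pow_dvd_iff]
    intro d hd
    interval_cases d
    · exact h0
    · exact hodd 1 odd_one
  · have h := macWilliams_poly hdeg hinv
    have h2 : (1 - X ^ 2 : ℚ[X]) ^ 2 ∣ C r * P := by
      rw [h]
      refine Finset.dvd_sum fun i hi => ?_
      have hi : i ≤ n := Nat.lt_succ_iff.1 (Finset.mem_range.1 hi)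
      by_cases hz : P.coeff i = 0
      · rw [hz]; simp
      have hi0 : i ≠ 0 := fun h => hz (h ▸ h0)
      have hi1 : ¬ Odd i := fun h => hz (hodd i h)
      have hin : i ≠ n := fun h => hz (h ▸ hn0)
      have : ∃ a b, n - i = 2 + a ∧ i = 2 + b := by
        rw [Nat.not_odd_iff_even] at hi1
        obtain ⟨s, hs⟩ := hn
        obtain ⟨t, ht⟩ := hi1
        exact ⟨n - i - 2, i - 2, by omega, by omega⟩
      obtain ⟨a, b, ha, hb⟩ := this
      rw [ha, pow_add, mul_assoc]
      nth_rewrite 2 [hb]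
      rw [pow_add]
      exact ⟨C (P.coeff i) * ((1 + X) ^ a * (1 - X) ^ b), by ring⟩
    exact (isUnit_C.2 hr.isUnit).dvd_mul_left.1 h2

theorem natDegree_gleasonFactor : gleasonFactor.natDegree = 6 := by
  rw [gleasonFactor]; compute_degree!

theorem gleasonFactor_ne_zero : gleasonFactor ≠ 0 := by
  intro h; have := natDegree_gleasonFactor; simp [h] at this

theorem coeff_sq_add_one_pow_of_odd (k : ℕ) {i : ℕ} (hi : Odd i) :
    ((1 + X ^ 2 : ℚ[X]) ^ k).coeff i = 0 := by
  have : (1 + X ^ 2 : ℚ[X]) ^ k = expand ℚ 2 ((1 + X) ^ k) := by simp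
  rw [this, coeff_expand (by norm_num), if_neg]
  rwa [← even_iff_two_dvd, Nat.not_even_iff_odd]

theorem coeff_of_gleasonFactor_mul {Q : ℚ[X]}
    (h : ∀ i, Odd i → (gleasonFactor * Q).coeff i = 0) (i : ℕ) (hi : Odd i) : Q.coeff i = 0 := by
  have key : ∀ P : ℚ[X], P.comp (C (-1) * X) = P ↔ ∀ i, Odd i → P.coeff i = 0 := by
    intro P
    rw [Polynomial.ext_iff]
    refine forall_congr' fun i => ?_
    rw [comp_C_mul_X_coeff]
    rcases Nat.even_or_odd i with he | ho
    · simp [he.neg_one_pow, Nat.not_odd_iff_even.2 he]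
    · simp only [ho.neg_one_pow, ho, forall_const]
      constructor <;> intro h <;> linarith
  refine (key Q).1 (mul_left_cancel₀ gleasonFactor_ne_zero ?_) i hi
  have h1 := (key _).2 h
  rw [mul_comp] at h1
  rw [← h1]
  congr 1
  simp [gleasonFactor]

/-- Gleason's theorem for lengths `n ≡ 4 (mod 8)`. -/
theorem exists_eq_codeForm (q : ℕ) : ∀ P : ℚ[X], P.natDegree ≤ 8 * q + 4 →
    (∀ i, Odd i → P.coeff i = 0) →
    (∀ y : ℚ, 1 < y → (1 + y) ^ (8 * q + 4) * P.eval ((1 - y) / (1 + y)) =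
      2 ^ (4 * q + 2) * P.eval y) → ∃ c, P = codeForm (8 * q + 4) c := by
  have reduce : ∀ q : ℕ, ∀ P : ℚ[X], P.natDegree ≤ 8 * q + 4 →
      (∀ i, Odd i → P.coeff i = 0) →
      (∀ y : ℚ, 1 < y → (1 + y) ^ (8 * q + 4) * P.eval ((1 - y) / (1 + y)) =
        2 ^ (4 * q + 2) * P.eval y) →
      ∃ R, P = C (P.coeff 0) * (1 + X ^ 2) ^ (4 * q + 2) + R ∧ gleasonFactor ∣ R ∧
        R.natDegree ≤ 8 * q + 2 ∧ (∀ i, Odd i → R.coeff i = 0) ∧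
        ∀ y : ℚ, 1 < y → (1 + y) ^ (8 * q + 4) * R.eval ((1 - y) / (1 + y)) =
          2 ^ (4 * q + 2) * R.eval y := by
    intro q P hdeg hodd hinv
    set R := P - C (P.coeff 0) * (1 + X ^ 2) ^ (4 * q + 2) with hR
    have e1 : R.natDegree ≤ 8 * q + 4 := by
      refine (natDegree_sub_le _ _).trans (max_le hdeg ?_)
      refine (natDegree_C_mul_le _ _).trans (natDegree_pow_le.trans ?_)
      have : (1 + X ^ 2 : ℚ[X]).natDegree ≤ 2 := by compute_degree
      nlinarith
    have e2 : ∀ i, Odd i → R.coeff i = 0 := by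
      intro i hi
      rw [hR, coeff_sub, coeff_C_mul, coeff_sq_add_one_pow_of_odd _ hi, hodd i hi]
      ring
    have e3 : ∀ y : ℚ, 1 < y → (1 + y) ^ (8 * q + 4) * R.eval ((1 - y) / (1 + y)) =
          2 ^ (4 * q + 2) * R.eval y := by
      intro y hy
      have h1 : (1 + y) ≠ 0 := by linarith
      have h2 : (1 + y) ^ 2 * (1 + ((1 - y) / (1 + y)) ^ 2) = 2 * (1 + y ^ 2) := by
        field_simp; ring
      simp only [hR, eval_sub, eval_mul, eval_C, eval_pow, eval_add, eval_one, eval_X, mul_sub,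
        hinv y hy]
      congr 1
      rw [show 8 * q + 4 = 2 * (4 * q + 2) by ring, pow_mul, mul_left_comm, ← mul_pow, h2, mul_pow]
      ring
    have e4 : R.coeff 0 = 0 := by
      rw [hR, coeff_sub, coeff_C_mul, coeff_zero_eq_eval_zero ((1 + X ^ 2 : ℚ[X]) ^ _)]
      simp
    have hr : (2 : ℚ) ^ (4 * q + 2) ≠ 0 := by positivity
    have hn : Even (8 * q + 4) := ⟨4 * q + 2, by ring⟩
    refine ⟨R, by rw [hR]; ring, gleasonFactor_dvd hn hr e1 e2 e3 e4, ?_, e2, e3⟩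
    -- The coefficient of degree 8q+4 vanishes by `coeff_extreme_eq_zero`, that of degree 8q+3 by
    -- parity.
    rw [natDegree_le_iff_coeff_eq_zero] at e1 ⊢
    intro i hi
    rcases lt_trichotomy i (8 * q + 4) with h | rfl | h
    · exact e2 i ⟨4 * q + 1, by omega⟩
    · exact coeff_extreme_eq_zero hr (natDegree_le_iff_coeff_eq_zero.2 e1) e2 e3 e4
    · exact e1 i h
  induction q with
  | zero =>
    intro P h1 h2 h3
    obtain ⟨R, hP, hd, hR, -, -⟩ := reduce 0 P h1 h2 h3
    -- A multiple of a polynomial of degree 6 that has degree at most 2.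
    have : R = 0 := eq_zero_of_dvd_of_natDegree_lt hd (by rw [natDegree_gleasonFactor]; omega)
    refine ⟨fun _ => P.coeff 0, ?_⟩
    rw [this, add_zero] at hP
    simpa [codeForm] using hP
  | succ q ih =>
    intro P h1 h2 h3
    obtain ⟨R, hP, ⟨Q, rfl⟩, hR, hodd, hinv⟩ := reduce (q + 1) P h1 h2 h3
    have hQ : Q.natDegree ≤ 8 * q + 4 := by
      by_cases hQ0 : Q = 0
      · simp [hQ0]
      · rw [natDegree_mul gleasonFactor_ne_zero hQ0, natDegree_gleasonFactor] at hR
        omega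
    obtain ⟨c, hc⟩ := ih Q hQ (coeff_of_gleasonFactor_mul hodd) fun y hy => by
      have h4 := hinv y hy
      have h5 : (1 + y) ≠ 0 := by linarith
      have h6 : y ^ 2 * (1 - y ^ 2) ^ 2 ≠ 0 := by
        have h8 : (1 - y ^ 2) ≠ 0 := by nlinarith
        positivity
      -- The factor is itself invariant, with length 8 and multiplier 16 = 2^4, so the quotient
      -- satisfies the hypotheses for length n - 8.
      have h7 : (1 + y) ^ 8 * (((1 - y) / (1 + y)) ^ 2 * (1 - ((1 - y) / (1 + y)) ^ 2) ^ 2) =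
          16 * (y ^ 2 * (1 - y ^ 2) ^ 2) := by
        field_simp; ring
      simp only [gleasonFactor, eval_mul, eval_pow, eval_sub, eval_one, eval_X] at h4
      refine mul_left_cancel₀ (mul_ne_zero (by norm_num : (16 : ℚ) ≠ 0) h6) ?_
      rw [show 8 * (q + 1) + 4 = 8 + (8 * q + 4) by ring, pow_add (1 + y) 8,
        show 4 * (q + 1) + 2 = 4 + (4 * q + 2) by ring, pow_add (2 : ℚ) 4] at h4
      linear_combination h4 - (1 + y) ^ (8 * q + 4) * eval ((1 - y) / (1 + y)) Q * h7
    refine ⟨fun j => if j = 0 then P.coeff 0 else c (j - 1), ?_⟩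
    have g1 : (8 * (q + 1) + 4) / 8 = q + 1 := by omega
    have g2 : (8 * (q + 1) + 4) / 2 = 4 * q + 6 := by omega
    have g3 : (8 * q + 4) / 8 = q := by omega
    have g4 : (8 * q + 4) / 2 = 4 * q + 2 := by omega
    rw [codeForm, g3, g4] at hc
    have hs : ∑ j ∈ Finset.range (q + 1), C (c j) * (1 + X ^ 2) ^ (4 * q + 6 - 4 * (j + 1)) *
        (X ^ 2 * (1 - X ^ 2) ^ 2) ^ (j + 1) = gleasonFactor * Q := by
      rw [hc, Finset.mul_sum]
      refine Finset.sum_congr rfl fun j _ => ?_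
      rw [show 4 * q + 6 - 4 * (j + 1) = 4 * q + 2 - 4 * j by omega, gleasonFactor]
      ring
    rw [codeForm, g1, g2, Finset.sum_range_succ']
    simp only [if_true, Nat.add_eq_zero_iff, one_ne_zero, and_false, if_false, Nat.add_sub_cancel,
      pow_zero, mul_one, mul_zero, Nat.sub_zero]
    rw [hs, add_comm, show 4 * q + 6 = 4 * (q + 1) + 2 by ring]
    exact hP

/-! ### MacWilliams transforms of self-dual codes and of their shadows. -/

/-- The nontrivial character of `ZMod 2`. -/
def signChar (a : ZMod 2) : ℚ := if a = 0 then 1 else -1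

theorem signChar_add (a b : ZMod 2) : signChar (a + b) = signChar a * signChar b := by
  have h : ∀ x : ZMod 2, x = 0 ∨ x = 1 := by decide
  have h2 : (1 : ZMod 2) + 1 = 0 := by decide
  rcases h a with rfl | rfl <;> rcases h b with rfl | rfl <;> simp [signChar, h2]

theorem signChar_sum {ι : Type*} (s : Finset ι) (f : ι → ZMod 2) :
    signChar (∑ i ∈ s, f i) = ∏ i ∈ s, signChar (f i) := by
  classical
  induction s using Finset.induction_on with
  | empty => simp [signChar]
  | insert a s ha ih => rw [Finset.sum_insert ha, Finset.prod_insert ha, signChar_add, ih]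

section
variable {n : ℕ}

theorem prod_ite_hammingNorm (x : Fin n → ZMod 2) (a b : ℚ) :
    ∏ i, (if x i = 0 then b else a) = a ^ hammingNorm x * b ^ (n - hammingNorm x) := by
  have h1 : (Finset.univ.filter fun i => ¬ x i = 0).card = hammingNorm x := rfl
  have h2 := Finset.card_filter_add_card_filter_not (s := (Finset.univ : Finset (Fin n)))
    (fun i => x i = 0)
  rw [h1, Finset.card_univ, Fintype.card_fin] at h2
  rw [Finset.prod_ite, Finset.prod_const, Finset.prod_const, h1, mul_comm]
  congr 2
  omega

/-- The summand is a product over coordinates, so the sum factors into n two-term sums: 1 - y where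
u is nonzero and 1 + y where it is zero. -/
theorem sum_signChar_dotProduct (u : Fin n → ZMod 2) (y : ℚ) :
    ∑ v : Fin n → ZMod 2, signChar (u ⬝ᵥ v) * y ^ hammingNorm v =
      (1 - y) ^ hammingNorm u * (1 + y) ^ (n - hammingNorm u) := by
  rw [← prod_ite_hammingNorm]
  have h1 : ∀ v : Fin n → ZMod 2, signChar (u ⬝ᵥ v) * y ^ hammingNorm v =
      ∏ i, (signChar (u i * v i) * if v i = 0 then 1 else y) := by
    intro v
    rw [Finset.prod_mul_distrib, prod_ite_hammingNorm, one_pow, mul_one, dotProduct, signChar_sum]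
  simp only [h1]
  rw [← Fintype.piFinset_univ, ← Finset.prod_univ_sum (fun _ => Finset.univ)
    (fun i a => signChar (u i * a) * if a = 0 then 1 else y)]
  refine Finset.prod_congr rfl fun i _ => ?_
  have h2 : (Finset.univ : Finset (ZMod 2)) = {0, 1} := by decide
  have h : ∀ x : ZMod 2, x = 0 ∨ x = 1 := by decide
  rw [h2, Finset.sum_pair (by decide)]
  rcases h (u i) with h | h <;> (simp [h, signChar]; try ring)

open Classical in
/-- Orthogonality for a sign-valued multiplicative function on a binary code. -/
theorem sum_eq_card_or_zero (C : Submodule (ZMod 2) (Fin n → ZMod 2)) (φ : (Fin n → ZMod 2) → ℚ)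
    (hmul : ∀ u ∈ C, ∀ v ∈ C, φ (u + v) = φ u * φ v) :
    ∑ u : Fin n → ZMod 2 with u ∈ C, φ u =
      if ∀ u ∈ C, φ u = 1 then (Nat.card C : ℚ) else 0 := by
  split_ifs with h
  · rw [Finset.sum_congr rfl fun u hu => h u (Finset.mem_filter.1 hu).2, Finset.sum_const,
      nsmul_one, Nat.card_eq_fintype_card, Fintype.card_subtype]
  · push Not at h
    obtain ⟨w, hw, hw1⟩ := h
    have key : φ w * ∑ u : Fin n → ZMod 2 with u ∈ C, φ u =
        ∑ u : Fin n → ZMod 2 with u ∈ C, φ u := by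
      rw [Finset.mul_sum]
      refine Finset.sum_bij' (fun u _ => w + u) (fun u _ => -w + u) ?_ ?_ ?_ ?_ ?_
      · intro u hu; simp only [Finset.mem_filter, Finset.mem_univ, true_and] at hu ⊢
        exact C.add_mem hw hu
      · intro u hu; simp only [Finset.mem_filter, Finset.mem_univ, true_and] at hu ⊢
        exact C.add_mem (C.neg_mem hw) hu
      · intro u _; simp
      · intro u _; simp
      · intro u hu; exact (hmul w hw u (Finset.mem_filter.1 hu).2).symm
    have : (φ w - 1) * ∑ u : Fin n → ZMod 2 with u ∈ C, φ u = 0 := by linear_combination key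
    exact (mul_eq_zero.1 this).resolve_left (sub_ne_zero.2 hw1)

open Classical in
/-- The MacWilliams transform of a sign-valued multiplicative function on a binary code. -/
theorem macWilliams_transform (C : Submodule (ZMod 2) (Fin n → ZMod 2))
    (φ : (Fin n → ZMod 2) → ℚ) (hmul : ∀ u ∈ C, ∀ v ∈ C, φ (u + v) = φ u * φ v) (y : ℚ) :
    ∑ u : Fin n → ZMod 2 with u ∈ C,
        φ u * ((1 - y) ^ hammingNorm u * (1 + y) ^ (n - hammingNorm u)) =
      Nat.card C * ∑ v : Fin n → ZMod 2 with ∀ u ∈ C, φ u * signChar (u ⬝ᵥ v) = 1,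
        y ^ hammingNorm v := by
  have h : ∀ v : Fin n → ZMod 2, ∑ u : Fin n → ZMod 2 with u ∈ C, φ u * signChar (u ⬝ᵥ v) =
      if ∀ u ∈ C, φ u * signChar (u ⬝ᵥ v) = 1 then (Nat.card C : ℚ) else 0 := fun v =>
    sum_eq_card_or_zero C (fun u => φ u * signChar (u ⬝ᵥ v)) fun u hu w hw => by
      rw [hmul u hu w hw, add_dotProduct, signChar_add]; ring
  simp only [← sum_signChar_dotProduct, Finset.mul_sum]
  rw [Finset.sum_comm, Finset.sum_filter]
  refine Finset.sum_congr rfl fun v _ => ?_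
  simp only [← mul_assoc, ← Finset.sum_mul]
  rw [h]
  split_ifs <;> simp

theorem eval_weightEnumerator (T : Set (Fin n → ZMod 2)) [DecidablePred (· ∈ T)] (y : ℚ) :
    (weightEnumerator T).eval y = ∑ x : Fin n → ZMod 2 with x ∈ T, y ^ hammingNorm x := by
  rw [weightEnumerator, eval_finsetSum]
  simp only [eval_pow, eval_X]
  congr!

theorem coeff_weightEnumerator (T : Set (Fin n → ZMod 2)) [DecidablePred (· ∈ T)] (w : ℕ) :
    (weightEnumerator T).coeff w =
      ((Finset.univ.filter fun x : Fin n → ZMod 2 => x ∈ T ∧ hammingNorm x = w).card : ℚ) := by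
  rw [weightEnumerator, finsetSum_coeff]
  simp only [coeff_X_pow]
  rw [Finset.sum_boole, Finset.filter_filter]
  congr! 4
  exact eq_comm

theorem two_mul_card_inter_add (x y : Fin n → ZMod 2) :
    hammingNorm (x + y) + 2 * (Finset.univ.filter fun i => x i ≠ 0 ∧ y i ≠ 0).card =
      hammingNorm x + hammingNorm y := by
  have h : ∀ a b : ZMod 2, (if a + b ≠ 0 then 1 else 0) + 2 * (if a ≠ 0 ∧ b ≠ 0 then 1 else 0) =
      (if a ≠ 0 then 1 else 0) + if b ≠ 0 then 1 else 0 := by decide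
  simp only [hammingNorm, Finset.card_filter, Finset.mul_sum, ← Finset.sum_add_distrib]
  exact Finset.sum_congr rfl fun i _ => h (x i) (y i)

theorem dotProduct_eq_card_inter (x y : Fin n → ZMod 2) :
    x ⬝ᵥ y = ((Finset.univ.filter fun i => x i ≠ 0 ∧ y i ≠ 0).card : ZMod 2) := by
  have h : ∀ a b : ZMod 2, a * b = if a ≠ 0 ∧ b ≠ 0 then 1 else 0 := by decide
  rw [dotProduct, ← Finset.sum_boole]
  exact Finset.sum_congr rfl fun i _ => h (x i) (y i)

theorem dotProduct_self_eq_hammingNorm (x : Fin n → ZMod 2) : x ⬝ᵥ x = (hammingNorm x : ZMod 2) := by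
  rw [dotProduct_eq_card_inter]
  simp [hammingNorm]

variable {C : Submodule (ZMod 2) (Fin n → ZMod 2)}

theorem IsSelfDualCode.mem_iff (hC : IsSelfDualCode C) (x : Fin n → ZMod 2) :
    x ∈ C ↔ ∀ y ∈ C, x ⬝ᵥ y = 0 :=
  ⟨fun h => by rw [IsSelfDualCode] at hC; rw [hC] at h; exact h,
    fun h => by rw [IsSelfDualCode] at hC; rw [hC]; exact h⟩

theorem IsSelfDualCode.even_hammingNorm (hC : IsSelfDualCode C) {x : Fin n → ZMod 2} (hx : x ∈ C) :
    Even (hammingNorm x) := by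
  have := (hC.mem_iff x).1 hx x hx
  rwa [dotProduct_self_eq_hammingNorm, ZMod.natCast_eq_zero_iff_even] at this

/-- The sign `(-1) ^ (wt x / 2)`. -/
def weightSign (x : Fin n → ZMod 2) : ℚ := (-1) ^ (hammingNorm x / 2)

theorem IsSelfDualCode.hammingNorm_add (hC : IsSelfDualCode C) {x y : Fin n → ZMod 2} (hx : x ∈ C)
    (hy : y ∈ C) : ∃ k, hammingNorm (x + y) + 4 * k = hammingNorm x + hammingNorm y := by
  have h := (hC.mem_iff x).1 hx y hy
  rw [dotProduct_eq_card_inter, ZMod.natCast_eq_zero_iff_even] at h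
  obtain ⟨k, hk⟩ := h
  exact ⟨k, by rw [← two_mul_card_inter_add, hk]; ring⟩

/-- Orthogonal codewords overlap in an even number of places, so weights add modulo 4. -/
theorem IsSelfDualCode.weightSign_add (hC : IsSelfDualCode C) : ∀ x ∈ C, ∀ y ∈ C,
    weightSign (x + y) = weightSign x * weightSign y := by
  intro x hx y hy
  obtain ⟨k, hk⟩ := hC.hammingNorm_add hx hy
  obtain ⟨a, ha⟩ := hC.even_hammingNorm hx
  obtain ⟨b, hb⟩ := hC.even_hammingNorm hy
  obtain ⟨c, hc⟩ := hC.even_hammingNorm (C.add_mem hx hy)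
  rw [weightSign, weightSign, weightSign, ha, hb, hc, ← pow_add]
  rw [ha, hb, hc] at hk
  rw [show (a + a) / 2 + (b + b) / 2 = (c + c) / 2 + 2 * k by omega, pow_add, pow_mul]
  simp

theorem weightSign_eq_one_or (x : Fin n → ZMod 2) : weightSign x = 1 ∨ weightSign x = -1 :=
  neg_one_pow_eq_or ℚ _

theorem IsSelfDualCode.weightSign_eq_one_iff (hC : IsSelfDualCode C) {x : Fin n → ZMod 2}
    (hx : x ∈ C) : weightSign x = 1 ↔ hammingNorm x % 4 = 0 := by
  obtain ⟨a, ha⟩ := hC.even_hammingNorm hx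
  rw [weightSign, neg_one_pow_eq_one_iff_even (by norm_num), Nat.even_iff]
  omega

theorem signChar_eq_one_iff (a : ZMod 2) : signChar a = 1 ↔ a = 0 := by
  unfold signChar; split_ifs with h <;> (simp [h]; try norm_num)

theorem signChar_eq_neg_one_iff (a : ZMod 2) : signChar a = -1 ↔ a ≠ 0 := by
  unfold signChar; split_ifs with h <;> (simp [h]; try norm_num)

/-- This exhibits the shadow as a fibre of v ↦ ((-1)^(u·v))_u, which is what `macWilliams_transform`
sums over when φ is `weightSign`. -/
theorem IsSinglyEvenSelfDual.mem_shadow_iff (hC : IsSinglyEvenSelfDual C) (v : Fin n → ZMod 2) :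
    v ∈ shadow C ↔ ∀ u ∈ C, weightSign u * signChar (u ⬝ᵥ v) = 1 := by
  obtain ⟨hC, x, hx, hx2⟩ := hC
  have hmem : v ∈ shadow C ↔ (∀ u ∈ C, hammingNorm u % 4 = 0 → v ⬝ᵥ u = 0) ∧ v ∉ C := by
    constructor
    · rintro ⟨h1, h2⟩; exact ⟨fun u hu h4 => h1 u ⟨hu, h4⟩, h2⟩
    · rintro ⟨h1, h2⟩; exact ⟨fun u hu => h1 u hu.1 hu.2, h2⟩
  rw [hmem]
  constructor
  · rintro ⟨h1, h2⟩ u hu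
    rcases weightSign_eq_one_or u with h | h
    · rw [h, one_mul, signChar_eq_one_iff, dotProduct_comm]
      exact h1 u hu ((hC.weightSign_eq_one_iff hu).1 h)
    -- As v is not in C, some codeword w has v·w ≠ 0, necessarily of weight 2 mod 4. Then u + w is
    -- doubly even, hence orthogonal to v, and u·v = w·v.
    · rw [hC.mem_iff] at h2
      push Not at h2
      obtain ⟨w, hw, hvw⟩ := h2
      have hw4 : weightSign w = -1 := (weightSign_eq_one_or w).resolve_left fun h =>
        hvw (h1 w hw ((hC.weightSign_eq_one_iff hw).1 h))
      have h3 : weightSign (u + w) = 1 := by rw [hC.weightSign_add u hu w hw, h, hw4]; norm_num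
      have h4 := h1 _ (C.add_mem hu hw) ((hC.weightSign_eq_one_iff (C.add_mem hu hw)).1 h3)
      have h5 : signChar (u ⬝ᵥ v) * signChar (w ⬝ᵥ v) = 1 := by
        rw [← signChar_add, ← add_dotProduct, dotProduct_comm, h4]; simp [signChar]
      have h6 : signChar (w ⬝ᵥ v) = -1 := by
        rw [signChar_eq_neg_one_iff, dotProduct_comm]; exact hvw
      rw [h6] at h5
      rw [h]; linarith
  · intro h
    refine ⟨fun u hu h4 => ?_, fun hv => ?_⟩
    · have := h u hu
      rwa [(hC.weightSign_eq_one_iff hu).2 h4, one_mul, signChar_eq_one_iff,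
        dotProduct_comm] at this
    · have := h x hx
      rw [dotProduct_comm, (hC.mem_iff v).1 hv x hx, (signChar_eq_one_iff 0).2 rfl, mul_one,
        hC.weightSign_eq_one_iff hx] at this
      omega

/-- Both vectors induce the same character on C, so their sum induces the trivial one and lies in
the dual, which is C. -/
theorem IsSinglyEvenSelfDual.add_mem_of_mem_shadow (hC : IsSinglyEvenSelfDual C)
    {u v : Fin n → ZMod 2} (hu : u ∈ shadow C) (hv : v ∈ shadow C) : u + v ∈ C := by
  rw [hC.mem_shadow_iff] at hu hv
  rw [hC.1.mem_iff]
  intro w hw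
  rw [dotProduct_comm, ← signChar_eq_one_iff, dotProduct_add, signChar_add]
  have h1 := hu w hw
  have h2 := hv w hw
  rcases weightSign_eq_one_or w with h | h <;> rw [h] at h1 h2
  · rw [one_mul] at h1 h2; rw [h1, h2, one_mul]
  · rw [show signChar (w ⬝ᵥ u) = -1 by linarith, show signChar (w ⬝ᵥ v) = -1 by linarith]
    norm_num

open Classical in
theorem natDegree_weightEnumerator_le (T : Set (Fin n → ZMod 2)) :
    (weightEnumerator T).natDegree ≤ n := by
  rw [natDegree_le_iff_coeff_eq_zero]
  intro w hw
  rw [coeff_weightEnumerator, Nat.cast_eq_zero, Finset.card_eq_zero, Finset.filter_eq_empty_iff]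
  rintro x - ⟨-, hx⟩
  have := hammingNorm_le_card_fintype (x := x)
  rw [Fintype.card_fin] at this
  omega

open Classical in
theorem coeff_weightEnumerator_eq_zero {T : Set (Fin n → ZMod 2)} {w : ℕ}
    (h : ∀ x ∈ T, hammingNorm x ≠ w) : (weightEnumerator T).coeff w = 0 := by
  rw [coeff_weightEnumerator, Nat.cast_eq_zero, Finset.card_eq_zero, Finset.filter_eq_empty_iff]
  rintro x - ⟨hx, hw⟩
  exact h x hx hw

open Classical in
theorem coeff_weightEnumerator_eq_one {T : Set (Fin n → ZMod 2)} {w : ℕ} {x : Fin n → ZMod 2}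
    (hx : x ∈ T) (hw : hammingNorm x = w) (h : ∀ v ∈ T, hammingNorm v = w → v = x) :
    (weightEnumerator T).coeff w = 1 := by
  rw [coeff_weightEnumerator, Nat.cast_eq_one, Finset.card_eq_one]
  refine ⟨x, Finset.eq_singleton_iff_unique_mem.2 ⟨by simp [hx, hw], fun v hv => ?_⟩⟩
  rw [Finset.mem_filter] at hv
  exact h v hv.2.1 hv.2.2

theorem hasNonnegIntCoeffs_weightEnumerator (T : Set (Fin n → ZMod 2)) :
    HasNonnegIntCoeffs (weightEnumerator T) := fun i => by
  classical
  exact ⟨_, coeff_weightEnumerator T i⟩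

theorem pow_mul_div_pow {y : ℚ} (hy : 1 + y ≠ 0) {w : ℕ} (hw : w ≤ n) :
    (1 + y) ^ n * ((1 - y) / (1 + y)) ^ w = (1 - y) ^ w * (1 + y) ^ (n - w) := by
  nth_rewrite 1 [← Nat.sub_add_cancel hw]
  rw [pow_add, div_pow]
  field_simp

open Classical in
theorem IsSelfDualCode.eval_weightEnumerator_macWilliams (hC : IsSelfDualCode C) {y : ℚ}
    (hy : 1 + y ≠ 0) :
    (1 + y) ^ n * (weightEnumerator (C : Set (Fin n → ZMod 2))).eval ((1 - y) / (1 + y)) =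
      Nat.card C * (weightEnumerator (C : Set (Fin n → ZMod 2))).eval y := by
  have h := macWilliams_transform C (fun _ => 1) (by simp) y
  have hset : ∀ v : Fin n → ZMod 2, (∀ u ∈ C, (1 : ℚ) * signChar (u ⬝ᵥ v) = 1) ↔
      v ∈ (C : Set (Fin n → ZMod 2)) := by
    intro v
    rw [SetLike.mem_coe, hC.mem_iff]
    simp only [one_mul, signChar_eq_one_iff, dotProduct_comm v]
  simp only [hset] at h
  simp only [one_mul] at h
  rw [eval_weightEnumerator, eval_weightEnumerator, ← h, Finset.mul_sum]
  refine Finset.sum_congr rfl fun u _ => ?_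
  have := hammingNorm_le_card_fintype (x := u)
  rw [Fintype.card_fin] at this
  exact pow_mul_div_pow hy this

-- For W = P(y^2), the sign (-1)^(wt u / 2) amounts to evaluating P at the negative of a square.
open Classical in
theorem IsSinglyEvenSelfDual.eval_weightEnumerator_shadow (hC : IsSinglyEvenSelfDual C)
    {P : ℚ[X]} (hP : weightEnumerator (C : Set (Fin n → ZMod 2)) = expand ℚ 2 P) {y : ℚ}
    (hy : 1 + y ≠ 0) :
    (1 + y) ^ n * P.eval (-((1 - y) / (1 + y)) ^ 2) =
      Nat.card C * (weightEnumerator (shadow C)).eval y := by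
  have h := macWilliams_transform C weightSign hC.1.weightSign_add y
  simp only [← hC.mem_shadow_iff] at h
  have hP2 : P = ∑ x : Fin n → ZMod 2 with x ∈ C, X ^ (hammingNorm x / 2) := by
    refine expand_injective (R := ℚ) (n := 2) (by norm_num) ?_
    rw [← hP, weightEnumerator, map_sum]
    simp only [SetLike.mem_coe]
    refine Finset.sum_congr (by congr!) fun x hx => ?_
    rw [map_pow, expand_X, ← pow_mul,
      Nat.mul_div_cancel' (hC.1.even_hammingNorm (Finset.mem_filter.1 hx).2).two_dvd]
  rw [eval_weightEnumerator, ← h, hP2, eval_finsetSum, Finset.mul_sum]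
  refine Finset.sum_congr rfl fun u hu => ?_
  have := hammingNorm_le_card_fintype (x := u)
  rw [Fintype.card_fin] at this
  rw [← pow_mul_div_pow hy this, weightSign, eval_pow, eval_X, neg_pow, ← pow_mul,
    Nat.mul_div_cancel' (hC.1.even_hammingNorm (Finset.mem_filter.1 hu).2).two_dvd]
  ring

end

/-- Under t = -((1-y)/(1+y))^2 the two building blocks of the code form become those of the shadow
form: 1 + t = 4y/(1+y)^2 and t(1-t)^2 = -4(1-y^4)^2/(1+y)^8. -/
theorem eval_codePoly_shadow (m : ℕ) (c : ℕ → ℚ) {y : ℚ} (hy : 1 + y ≠ 0) :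
    (1 + y) ^ (24 * m + 4) * (codePoly m c).eval (-((1 - y) / (1 + y)) ^ 2) =
      2 ^ (12 * m + 2) * (shadowForm (24 * m + 4) c).eval y := by
  have g1 : (24 * m + 4) / 8 = 3 * m := by omega
  have g2 : (24 * m + 4) / 2 = 12 * m + 2 := by omega
  rw [shadowForm, g1, g2, codePoly, eval_finsetSum, eval_finsetSum, Finset.mul_sum, Finset.mul_sum]
  refine Finset.sum_congr rfl fun j hj => ?_
  have hj : j ≤ 3 * m := Nat.lt_succ_iff.1 (Finset.mem_range.1 hj)
  obtain ⟨a, ha⟩ : ∃ a, 12 * m + 2 = 4 * j + a := ⟨12 * m + 2 - 4 * j, by omega⟩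
  have e1 : (1 + y) ^ 2 * (1 + -((1 - y) / (1 + y)) ^ 2) = 4 * y := by field_simp; ring
  have e2 : (1 + y) ^ 8 * (-((1 - y) / (1 + y)) ^ 2 * (1 - -((1 - y) / (1 + y)) ^ 2) ^ 2) =
      -4 * (1 - y ^ 4) ^ 2 := by field_simp; ring
  have e3 : (1 + y) ^ (24 * m + 4) = ((1 + y) ^ 2) ^ a * ((1 + y) ^ 8) ^ j := by
    rw [← pow_mul, ← pow_mul, ← pow_add]; congr 1; omega
  have e4 : (2 : ℚ) ^ (((12 * m + 2 : ℕ) : ℤ) - 6 * (j : ℤ)) * 64 ^ j = 2 ^ (12 * m + 2) := by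
    rw [zpow_sub₀ two_ne_zero, zpow_natCast, zpow_mul, zpow_natCast]
    norm_num
  have e5 : (2 : ℚ) ^ (12 * m + 2) = 16 ^ j * 2 ^ a := by
    rw [ha, pow_add, pow_mul]; norm_num
  simp only [eval_mul, eval_C, eval_pow, eval_add, eval_sub, eval_one, eval_X]
  rw [show 12 * m + 2 - 4 * j = a by omega, e3]
  have e6 : (4 : ℚ) ^ a = 2 ^ a * 2 ^ a := by rw [← mul_pow]; norm_num
  have e7 : (64 : ℚ) ^ j = 4 ^ j * 16 ^ j := by rw [← mul_pow]; norm_num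
  calc ((1 + y) ^ 2) ^ a * ((1 + y) ^ 8) ^ j * (c j * (1 + -((1 - y) / (1 + y)) ^ 2) ^ a *
        (-((1 - y) / (1 + y)) ^ 2 * (1 - -((1 - y) / (1 + y)) ^ 2) ^ 2) ^ j)
      = c j * ((1 + y) ^ 2 * (1 + -((1 - y) / (1 + y)) ^ 2)) ^ a *
        ((1 + y) ^ 8 * (-((1 - y) / (1 + y)) ^ 2 *
          (1 - -((1 - y) / (1 + y)) ^ 2) ^ 2)) ^ j := by
        rw [mul_pow ((1 + y) ^ 2), mul_pow ((1 + y) ^ 8)]; ring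
    _ = c j * (4 ^ a * y ^ a) * ((-1) ^ j * 4 ^ j * (1 - y ^ 4) ^ (2 * j)) := by
        rw [e1, e2, mul_pow, mul_pow, ← pow_mul, show (-4 : ℚ) = -1 * 4 by norm_num, mul_pow]
    _ = _ := by
        have h16 : (16 : ℚ) ^ j ≠ 0 := by positivity
        have e8 : (2 : ℚ) ^ a = 2 ^ (((12 * m + 2 : ℕ) : ℤ) - 6 * (j : ℤ)) * 4 ^ j := by
          refine mul_left_cancel₀ h16 ?_
          rw [← e5, ← e4, e7]; ring
        rw [e5, e6]
        have e9 : (16 : ℚ) ^ j = 4 ^ j * 4 ^ j := by rw [← mul_pow]; norm_num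
        rw [e9]
        linear_combination
          (c j * 2 ^ a * y ^ a * (-1) ^ j * (1 - y ^ 4) ^ (2 * j) * 4 ^ j) * e8

/-! ### Codes with minimal shadow give enumerator pairs. -/

section
variable {m : ℕ} {C : Submodule (ZMod 2) (Fin (24 * m + 4) → ZMod 2)}

/-- The enumerators of a code with minimal shadow have the form of the Gleason and Conway–Sloane
theorems. -/
theorem IsSinglyEvenSelfDual.exists_codeForm (hC : IsSinglyEvenSelfDual C)
    (hk : Module.finrank (ZMod 2) C = 12 * m + 2) :
    ∃ c, weightEnumerator (C : Set (Fin (24 * m + 4) → ZMod 2)) = codeForm (24 * m + 4) c ∧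
      weightEnumerator (shadow C) = shadowForm (24 * m + 4) c := by
  have hcard : (Nat.card C : ℚ) = 2 ^ (12 * m + 2) := by
    have := Module.natCard_eq_pow_finrank (K := ZMod 2) (V := C)
    rw [hk, Nat.card_zmod] at this
    exact_mod_cast this
  have h8 : 24 * m + 4 = 8 * (3 * m) + 4 := by ring
  obtain ⟨c, hc⟩ := exists_eq_codeForm (3 * m) (weightEnumerator (C : Set _))
    ((natDegree_weightEnumerator_le _).trans h8.le)
    (fun i hi => coeff_weightEnumerator_eq_zero fun x hx hw =>
      Nat.not_even_iff_odd.2 hi (hw ▸ hC.1.even_hammingNorm hx))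
    (fun y hy => by
      rw [← h8, hC.1.eval_weightEnumerator_macWilliams (by linarith), hcard]
      congr 2; ring)
  rw [← h8] at hc
  refine ⟨c, hc, ?_⟩
  refine eq_of_infinite_eval_eq _ _ ((Set.Ioi_infinite (1 : ℚ)).mono fun y hy => ?_)
  have hy : 1 < y := hy
  have h1 := hC.eval_weightEnumerator_shadow (hc.trans (codeForm_eq_expand m c))
    (y := y) (by linarith)
  rw [eval_codePoly_shadow m c (by linarith), hcard] at h1
  exact (mul_left_cancel₀ (by positivity) h1).symm

theorem IsMinimalShadowCode.isEnumeratorPair (hm : 1 ≤ m) (h : IsMinimalShadowCode m C) :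
    IsEnumeratorPair m (weightEnumerator (C : Set (Fin (24 * m + 4) → ZMod 2)))
      (weightEnumerator (shadow C)) := by
  obtain ⟨hC, ⟨hk, -, hmin⟩, ⟨s, hs, hs0, hs2⟩, -⟩ := h
  have hw2 : minimalShadowWeight (24 * m + 4) = 2 := by
    rw [minimalShadowWeight, if_neg (by omega)]; omega
  rw [hw2] at hs2
  have hmin : ∀ x ∈ C, x ≠ 0 → 4 * m + 2 ≤ hammingNorm x := fun x hx h0 => hmin ⟨x, hx, h0, rfl⟩
  -- v + s is a codeword of weight at most wt v + 2 < 4m + 2, hence zero.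
  have huniq : ∀ v ∈ shadow C, hammingNorm v < 4 * m → v = s := by
    intro v hv hvw
    have hmem := hC.add_mem_of_mem_shadow hv hs
    have hle := two_mul_card_inter_add v s
    by_contra hne
    have hne0 : v + s ≠ 0 := by
      intro h
      apply hne
      have h2 : s + s = 0 := by ext i; exact CharTwo.add_self_eq_zero _
      rw [← add_zero v, ← h2, ← add_assoc, h, zero_add]
    have := hmin _ hmem hne0
    omega
  refine ⟨hC.exists_codeForm hk, ?_, fun i h1 h2 => ?_, ?_, fun i h1 h2 => ?_⟩
  · refine coeff_weightEnumerator_eq_one (x := 0) C.zero_mem hammingNorm_zero fun v _ hv => ?_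
    exact hammingNorm_eq_zero.1 hv
  · refine coeff_weightEnumerator_eq_zero fun x hx hw => ?_
    have h0 : x ≠ 0 := by
      rintro rfl
      rw [hammingNorm_zero] at hw
      omega
    have := hmin x hx h0
    omega
  · refine coeff_weightEnumerator_eq_one hs hs2 fun v hv hv2 => huniq v hv (by omega)
  · refine coeff_weightEnumerator_eq_zero fun x hx hw => ?_
    have := huniq x hx (by omega)
    rw [this] at hw
    omega

end

/-! ### Lagrange inversion and a closed form for b_{m+1}. -/

namespace PowerSeries

/-- The power series `1 / (1 - X)`. -/
noncomputable def invOneSub : ℚ⟦X⟧ := PowerSeries.mk 1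

/-- The power series `1 / (1 - X ^ 2)`. -/
noncomputable def invOneSubSq : ℚ⟦X⟧ := expand 2 two_ne_zero invOneSub

theorem invOneSub_mul : invOneSub * (1 - X) = 1 := mk_one_mul_one_sub_eq_one ℚ

theorem invOneSubSq_mul : invOneSubSq * (1 - X ^ 2) = 1 := by
  have := congrArg (expand 2 two_ne_zero) invOneSub_mul
  simpa [invOneSubSq] using this

theorem coeff_invOneSub_pow (d n : ℕ) :
    coeff n (invOneSub ^ (d + 1)) = ((d + n).choose d : ℚ) := by
  rw [invOneSub, mk_one_pow_eq_mk_choose_add, coeff_mk]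

theorem coeff_invOneSubSq_pow_even (d n : ℕ) :
    coeff (2 * n) (invOneSubSq ^ (d + 1)) = ((d + n).choose d : ℚ) := by
  rw [invOneSubSq, ← map_pow, coeff_expand_mul, coeff_invOneSub_pow]

theorem coeff_invOneSubSq_pow_odd (d n : ℕ) :
    coeff (2 * n + 1) (invOneSubSq ^ (d + 1)) = 0 := by
  rw [invOneSubSq, ← map_pow, coeff_expand_of_not_dvd]
  omega

theorem derivative_invOneSub : d⁄dX ℚ invOneSub = invOneSub ^ 2 := by
  ext n
  rw [coeff_derivative, coeff_invOneSub_pow 1 n, invOneSub, coeff_mk]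
  simp [add_comm]

theorem coeff_X_mul_derivative (f : ℚ⟦X⟧) (r : ℕ) :
    coeff r (X * d⁄dX ℚ f) = r * coeff r f := by
  rcases r with _ | r
  · simp
  · rw [coeff_succ_X_mul, coeff_derivative]; push_cast; ring

/-- With f = t(1-t)^2/(1+t)^4 one has t f'/f = (1-6t+t^2)/(1-t^2). The claim is that the derivative
of f^(-r) has residue zero; the proof applies t d/dt to (t/f)^r, which multiplies the coefficient of
t^r by r. -/
theorem coeff_code_orthogonal {r : ℕ} (hr : 1 ≤ r) :
    coeff r ((1 + X : ℚ⟦X⟧) ^ (4 * r - 1) * invOneSub ^ (2 * r + 1) * (1 - 6 * X + X ^ 2)) = 0 := by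
  obtain ⟨s, rfl⟩ : ∃ s, r = s + 1 := ⟨r - 1, by omega⟩
  have h1 := coeff_X_mul_derivative
    ((1 + X : ℚ⟦X⟧) ^ (4 * (s + 1)) * invOneSub ^ (2 * (s + 1))) (s + 1)
  have hd : d⁄dX ℚ (1 + X : ℚ⟦X⟧) = 1 := by simp
  have key : X * d⁄dX ℚ ((1 + X : ℚ⟦X⟧) ^ (4 * (s + 1)) * invOneSub ^ (2 * (s + 1))) =
      C ((s + 1 : ℕ) : ℚ) * ((1 + X : ℚ⟦X⟧) ^ (4 * (s + 1)) * invOneSub ^ (2 * (s + 1))) -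
      C ((s + 1 : ℕ) : ℚ) * ((1 + X : ℚ⟦X⟧) ^ (4 * (s + 1) - 1) * invOneSub ^ (2 * (s + 1) + 1) *
        (1 - 6 * X + X ^ 2)) := by
    rw [Derivation.leibniz, smul_eq_mul, smul_eq_mul, derivative_pow, derivative_pow, hd,
      derivative_invOneSub, show 4 * (s + 1) - 1 = 4 * s + 3 by omega,
      show 2 * (s + 1) - 1 = 2 * s + 1 by omega, map_natCast]
    push_cast
    have h := invOneSub_mul
    linear_combination (4 * (s + 1) * X * (1 + X) ^ (4 * s + 3) * invOneSub ^ (2 * s + 2) -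
      (s + 1) * (1 + X) ^ (4 * s + 4) * invOneSub ^ (2 * s + 2)) * -h
  rw [key, map_sub, coeff_C_mul, coeff_C_mul] at h1
  have h2 : ((s + 1 : ℕ) : ℚ) ≠ 0 := by positivity
  have h3 : ((s + 1 : ℕ) : ℚ) * coeff (s + 1) ((1 + X : ℚ⟦X⟧) ^ (4 * (s + 1) - 1) *
    invOneSub ^ (2 * (s + 1) + 1) * (1 - 6 * X + X ^ 2)) = 0 := by linarith
  exact (mul_eq_zero.1 h3).resolve_left h2

/-- The same residue argument for g = u/(1-u)^2, where u g'/g = (1+u)/(1-u). -/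
theorem coeff_shadow_orthogonal {r : ℕ} (hr : 1 ≤ r) :
    coeff r ((1 - X : ℚ⟦X⟧) ^ (2 * r - 1) * (1 + X)) = 0 := by
  obtain ⟨s, rfl⟩ : ∃ s, r = s + 1 := ⟨r - 1, by omega⟩
  have h1 := coeff_X_mul_derivative ((1 - X : ℚ⟦X⟧) ^ (2 * (s + 1))) (s + 1)
  have hd : d⁄dX ℚ (1 - X : ℚ⟦X⟧) = -1 := by simp
  have key : X * d⁄dX ℚ ((1 - X : ℚ⟦X⟧) ^ (2 * (s + 1))) =
      C ((s + 1 : ℕ) : ℚ) * ((1 - X : ℚ⟦X⟧) ^ (2 * (s + 1))) -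
      C ((s + 1 : ℕ) : ℚ) * ((1 - X : ℚ⟦X⟧) ^ (2 * (s + 1) - 1) * (1 + X)) := by
    rw [derivative_pow, hd, show 2 * (s + 1) - 1 = 2 * s + 1 by omega, map_natCast]
    push_cast
    ring
  rw [key, map_sub, coeff_C_mul, coeff_C_mul] at h1
  have h2 : ((s + 1 : ℕ) : ℚ) ≠ 0 := by positivity
  have h3 : ((s + 1 : ℕ) : ℚ) * coeff (s + 1) ((1 - X : ℚ⟦X⟧) ^ (2 * (s + 1) - 1) * (1 + X)) = 0 := by
    linarith
  exact (mul_eq_zero.1 h3).resolve_left h2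

theorem coeff_dual_sum {L i : ℕ} (hi : i < L) (c : ℕ → ℚ) (U : ℕ → ℚ⟦X⟧) (K : ℚ⟦X⟧)
    (h0 : coeff 0 (U i * K) = 1) (h : ∀ r, 1 ≤ r → r ≤ i → coeff r (U (i - r) * K) = 0) :
    coeff i ((∑ j ∈ Finset.range L, C (c j) * X ^ j * U j) * K) = c i := by
  rw [Finset.sum_mul, map_sum, Finset.sum_eq_single i]
  · rw [mul_assoc, mul_assoc, coeff_C_mul, coeff_X_pow_mul', if_pos le_rfl, Nat.sub_self, h0,
      mul_one]
  · intro j _ hji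
    rw [mul_assoc, mul_assoc, coeff_C_mul, coeff_X_pow_mul']
    split_ifs with hj
    · have := h (i - j) (by omega) (by omega)
      rw [show i - (i - j) = j by omega] at this
      rw [this, mul_zero]
    · rw [mul_zero]
  · intro h; exact absurd (Finset.mem_range.2 hi) h

/-- Lagrange–Bürmann inversion: the kernel is (1-u)^(-6m) (u/g)^i · u g'/g with g = u/(1-u)^2. -/
theorem shadowSeq_eq_coeff {m i : ℕ} (hi : i ≤ 3 * m) (d : ℕ → ℚ) :
    coeff i ((shadowPoly m d : ℚ⟦X⟧) * (invOneSub ^ (6 * m - 2 * i + 1) * (1 + X))) = d i := by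
  have h : (shadowPoly m d : ℚ⟦X⟧) =
      ∑ j ∈ Finset.range (3 * m + 1), C (d j) * X ^ j * (1 - X) ^ (6 * m - 2 * j) := by
    rw [shadowPoly, ← Polynomial.coeToPowerSeries.ringHom_apply, map_sum]
    simp
  have hp : ∀ a, invOneSub ^ a * (1 - X) ^ a = 1 := fun a => by
    rw [← mul_pow, invOneSub_mul, one_pow]
  rw [h]
  refine coeff_dual_sum (Nat.lt_succ_of_le hi) d (fun j => (1 - X) ^ (6 * m - 2 * j)) _ ?_ ?_
  · rw [pow_succ, show (1 - X : ℚ⟦X⟧) ^ (6 * m - 2 * i) *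
      (invOneSub ^ (6 * m - 2 * i) * invOneSub * (1 + X)) =
      (invOneSub ^ (6 * m - 2 * i) * (1 - X) ^ (6 * m - 2 * i)) * (invOneSub * (1 + X)) by ring, hp]
    simp [invOneSub]
  · intro r h1 h2
    rw [show 6 * m - 2 * (i - r) = (6 * m - 2 * i + 1) + (2 * r - 1) by omega, pow_add,
      show (1 - X : ℚ⟦X⟧) ^ (6 * m - 2 * i + 1) * (1 - X) ^ (2 * r - 1) *
      (invOneSub ^ (6 * m - 2 * i + 1) * (1 + X)) =
      (invOneSub ^ (6 * m - 2 * i + 1) * (1 - X) ^ (6 * m - 2 * i + 1)) *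
        ((1 - X) ^ (2 * r - 1) * (1 + X)) by ring, hp, one_mul]
    exact coeff_shadow_orthogonal h1

/-- The kernel is (1+t)^(-(12m+2)) (t/f)^i · t f'/f with f = t(1-t)^2/(1+t)^4; `(1 - X) *
invOneSubSq` is 1/(1+t). -/
theorem codeSeq_eq_coeff {m i : ℕ} (hi : i ≤ 3 * m) (c : ℕ → ℚ) :
    coeff i ((codePoly m c : ℚ⟦X⟧) * (((1 - X) * invOneSubSq) ^ (12 * m + 2 - 4 * i + 1) *
      invOneSub ^ (2 * i + 1) * (1 - 6 * X + X ^ 2))) = c i := by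
  have h : (codePoly m c : ℚ⟦X⟧) = ∑ j ∈ Finset.range (3 * m + 1), C (c j) * X ^ j *
      ((1 + X) ^ (12 * m + 2 - 4 * j) * (1 - X) ^ (2 * j)) := by
    rw [codePoly, ← Polynomial.coeToPowerSeries.ringHom_apply, map_sum]
    refine Finset.sum_congr rfl fun j _ => ?_
    simp [mul_pow, ← pow_mul]
    ring
  have hp : ∀ a, invOneSub ^ a * (1 - X) ^ a = 1 := fun a => by
    rw [← mul_pow, invOneSub_mul, one_pow]
  have hq : ∀ a, ((1 - X) * invOneSubSq) ^ a * (1 + X) ^ a = 1 := fun a => by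
    rw [← mul_pow, show (1 - X) * invOneSubSq * (1 + X) = invOneSubSq * (1 - X ^ 2) by ring,
      invOneSubSq_mul, one_pow]
  rw [h]
  refine coeff_dual_sum (Nat.lt_succ_of_le hi) c
    (fun j => (1 + X) ^ (12 * m + 2 - 4 * j) * (1 - X) ^ (2 * j)) _ ?_ ?_
  · simp [invOneSub, invOneSubSq]
  · intro r h1 h2
    have e1 : (1 + X : ℚ⟦X⟧) ^ (12 * m + 2 - 4 * (i - r)) =
        (1 + X) ^ (12 * m + 2 - 4 * i + 1) * (1 + X) ^ (4 * r - 1) := by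
      rw [← pow_add]; congr 1; omega
    have e2 : invOneSub ^ (2 * i + 1) = invOneSub ^ (2 * (i - r)) * invOneSub ^ (2 * r + 1) := by
      rw [← pow_add]; congr 1; omega
    rw [e1, e2]
    calc _ = coeff r ((((1 - X) * invOneSubSq) ^ (12 * m + 2 - 4 * i + 1) *
          (1 + X) ^ (12 * m + 2 - 4 * i + 1)) *
          (invOneSub ^ (2 * (i - r)) * (1 - X) ^ (2 * (i - r))) *
          ((1 + X : ℚ⟦X⟧) ^ (4 * r - 1) * invOneSub ^ (2 * r + 1) * (1 - 6 * X + X ^ 2))) := by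
          congr 1; ring
      _ = 0 := by rw [hp, hq, one_mul, one_mul]; exact coeff_code_orthogonal h1

/-- F = 1 + O(X^m), so multiplication by F affects K only from degree m on. -/
theorem coeff_mul_of_gap {m : ℕ} (hm : 1 ≤ m) {F : ℚ⟦X⟧} (h0 : coeff 0 F = 1)
    (h : ∀ i, 1 ≤ i → i < m → coeff i F = 0) (K : ℚ⟦X⟧) :
    (∀ i < m, coeff i (F * K) = coeff i K) ∧
    coeff m (F * K) = coeff m K + coeff m F * coeff 0 K ∧
    coeff (m + 1) (F * K) = coeff (m + 1) K + coeff m F * coeff 1 K +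
      coeff (m + 1) F * coeff 0 K := by
  have key : ∀ M n, 1 ≤ M → M ≤ m → ∑ k ∈ Finset.range M, coeff k F * coeff (n - k) K =
      coeff n K := by
    intro M n hM1 hM
    obtain ⟨M, rfl⟩ : ∃ M', M = M' + 1 := ⟨M - 1, by omega⟩
    rw [Finset.sum_range_succ', h0, one_mul, Nat.sub_zero, Finset.sum_eq_zero, zero_add]
    intro k hk
    have := Finset.mem_range.1 hk
    rw [h (k + 1) (by omega) (by omega), zero_mul]
  refine ⟨fun i hi => ?_, ?_, ?_⟩
  · rw [coeff_mul, Finset.Nat.sum_antidiagonal_eq_sum_range_succ_mk]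
    exact key (i + 1) i (by omega) (by omega)
  · rw [coeff_mul, Finset.Nat.sum_antidiagonal_eq_sum_range_succ_mk, Finset.sum_range_succ]
    simp only
    rw [key m m hm le_rfl, Nat.sub_self]
  · rw [coeff_mul, Finset.Nat.sum_antidiagonal_eq_sum_range_succ_mk, Finset.sum_range_succ,
      Finset.sum_range_succ]
    simp only
    rw [key m (m + 1) hm le_rfl, Nat.sub_self, Nat.add_sub_cancel_left]

theorem coeff_shadowKernel (d n : ℕ) :
    coeff (n + 1) (invOneSub ^ (d + 1) * (1 + X)) =
      ((d + (n + 1)).choose d : ℚ) + ((d + n).choose d : ℚ) := by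
  rw [mul_add, mul_one, map_add, coeff_succ_mul_X, coeff_invOneSub_pow, coeff_invOneSub_pow]

theorem coeff_zero_shadowKernel (d : ℕ) : coeff 0 (invOneSub ^ (d + 1) * (1 + X)) = 1 := by
  simp [invOneSub]

variable {p : ℕ} {c : ℕ → ℚ}

theorem _root_.IsEnumeratorSeq.coeff_mul_eq {m i : ℕ} {c : ℕ → ℚ} (h : IsEnumeratorSeq m c)
    (hi : i ≤ 2 * m) (K : ℚ⟦X⟧) : coeff i ((codePoly m c : ℚ⟦X⟧) * K) = coeff i K :=
  (coeff_mul_of_gap (m := 2 * m + 1) (by omega) (F := (codePoly m c : ℚ⟦X⟧))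
    (by rw [Polynomial.coeff_coe]; exact h.1)
    (fun j h1 h2 => by rw [Polynomial.coeff_coe]; exact h.2.1 j h1 (by omega)) K).1 i (by omega)

/-- The coefficient `c_{2m}` for `m = p + 5`. -/
theorem _root_.IsEnumeratorSeq.apply_two_mul (h : IsEnumeratorSeq (p + 5) c) :
    c (2 * (p + 5)) = ((5 * p + 27).choose (4 * p + 22) : ℚ) +
      14 * (5 * p + 26).choose (4 * p + 22) + (5 * p + 25).choose (4 * p + 22) := by
  have hc := codeSeq_eq_coeff (m := p + 5) (i := 2 * (p + 5)) (by omega) c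
  rw [h.coeff_mul_eq le_rfl, show 12 * (p + 5) + 2 - 4 * (2 * (p + 5)) + 1 = 4 * p + 22 + 1 by omega,
    show 2 * (2 * (p + 5)) + 1 = 4 * p + 21 by ring] at hc
  have hp : invOneSub ^ (4 * p + 21) * (1 - X) ^ (4 * p + 21) = 1 := by
    rw [← mul_pow, invOneSub_mul, one_pow]
  -- The kernel is (1-t^2)^(-(4m+3)) times (1-t)^2 (1-6t+t^2). As 2m is even, only the even
  -- coefficients 1, 14, 1 of the latter matter.
  have e : ((1 - X) * invOneSubSq) ^ (4 * p + 22 + 1) * invOneSub ^ (4 * p + 21) *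
      (1 - 6 * X + X ^ 2) = invOneSubSq ^ (4 * p + 22 + 1) - C 8 * (X ^ 1 * invOneSubSq ^ (4 * p + 22 + 1))
        + C 14 * (X ^ 2 * invOneSubSq ^ (4 * p + 22 + 1))
        - C 8 * (X ^ 3 * invOneSubSq ^ (4 * p + 22 + 1)) + X ^ 4 * invOneSubSq ^ (4 * p + 22 + 1) := by
    have h8 : (C 8 : ℚ⟦X⟧) = 8 := rfl
    have h14 : (C 14 : ℚ⟦X⟧) = 14 := rfl
    rw [mul_pow, show 4 * p + 22 + 1 = 4 * p + 21 + 2 by ring, pow_add (1 - X : ℚ⟦X⟧), h8, h14]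
    linear_combination ((1 - X) ^ 2 * (1 - 6 * X + X ^ 2) * invOneSubSq ^ (4 * p + 21 + 2)) * hp
  rw [e] at hc
  simp only [map_add, map_sub, coeff_C_mul, coeff_X_pow_mul'] at hc
  rw [if_pos (by omega), if_pos (by omega), if_pos (by omega), if_pos (by omega),
    show 2 * (p + 5) - 1 = 2 * (p + 4) + 1 by omega, show 2 * (p + 5) - 2 = 2 * (p + 4) by omega,
    show 2 * (p + 5) - 3 = 2 * (p + 3) + 1 by omega, show 2 * (p + 5) - 4 = 2 * (p + 3) by omega] at hc
  simp only [coeff_invOneSubSq_pow_odd, coeff_invOneSubSq_pow_even] at hc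
  rw [← hc, show 4 * p + 22 + (p + 5) = 5 * p + 27 by ring,
    show 4 * p + 22 + (p + 4) = 5 * p + 26 by ring, show 4 * p + 22 + (p + 3) = 5 * p + 25 by ring]
  ring

/-- The coefficient `c_{2m-1}` for `m = p + 5`. -/
theorem _root_.IsEnumeratorSeq.apply_two_mul_sub_one (h : IsEnumeratorSeq (p + 5) c) :
    c (2 * p + 9) = -(14 * ((5 * p + 30).choose (4 * p + 26) : ℚ) +
      232 * (5 * p + 29).choose (4 * p + 26) + 532 * (5 * p + 28).choose (4 * p + 26) +
      232 * (5 * p + 27).choose (4 * p + 26) + 14 * (5 * p + 26).choose (4 * p + 26)) := by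
  have hc := codeSeq_eq_coeff (m := p + 5) (i := 2 * p + 9) (by omega) c
  rw [h.coeff_mul_eq (by omega), show 12 * (p + 5) + 2 - 4 * (2 * p + 9) + 1 = 4 * p + 26 + 1 by omega,
    show 2 * (2 * p + 9) + 1 = 4 * p + 19 by ring] at hc
  have hp : invOneSub ^ (4 * p + 19) * (1 - X) ^ (4 * p + 19) = 1 := by
    rw [← mul_pow, invOneSub_mul, one_pow]
  set w := invOneSubSq ^ (4 * p + 26 + 1) with hw
  -- Here the numerator is (1-t)^8 (1-6t+t^2); as 2m-1 is odd, only its odd coefficients survive.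
  have e : ((1 - X) * invOneSubSq) ^ (4 * p + 26 + 1) * invOneSub ^ (4 * p + 19) *
      (1 - 6 * X + X ^ 2) = w - C 14 * (X ^ 1 * w) + C 77 * (X ^ 2 * w) - C 232 * (X ^ 3 * w) +
        C 434 * (X ^ 4 * w) - C 532 * (X ^ 5 * w) + C 434 * (X ^ 6 * w) - C 232 * (X ^ 7 * w) +
        C 77 * (X ^ 8 * w) - C 14 * (X ^ 9 * w) + X ^ 10 * w := by
    have h14 : (C 14 : ℚ⟦X⟧) = 14 := rfl
    have h77 : (C 77 : ℚ⟦X⟧) = 77 := rfl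
    have h232 : (C 232 : ℚ⟦X⟧) = 232 := rfl
    have h434 : (C 434 : ℚ⟦X⟧) = 434 := rfl
    have h532 : (C 532 : ℚ⟦X⟧) = 532 := rfl
    rw [mul_pow, ← hw, show 4 * p + 26 + 1 = 4 * p + 19 + 8 by ring, pow_add (1 - X : ℚ⟦X⟧), h14, h77,
      h232, h434, h532]
    linear_combination ((1 - X) ^ 8 * (1 - 6 * X + X ^ 2) * w) * hp
  rw [e] at hc
  simp only [map_add, map_sub, coeff_C_mul, coeff_X_pow_mul'] at hc
  rw [if_pos (by omega), if_pos (by omega), if_pos (by omega), if_pos (by omega), if_pos (by omega),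
    if_pos (by omega), if_pos (by omega), if_pos (by omega), if_pos (by omega),
    show 2 * p + 9 = 2 * (p + 4) + 1 by ring, show 2 * (p + 4) + 1 - 1 = 2 * (p + 4) by omega,
    show 2 * (p + 4) + 1 - 2 = 2 * (p + 3) + 1 by omega,
    show 2 * (p + 4) + 1 - 3 = 2 * (p + 3) by omega,
    show 2 * (p + 4) + 1 - 4 = 2 * (p + 2) + 1 by omega,
    show 2 * (p + 4) + 1 - 5 = 2 * (p + 2) by omega,
    show 2 * (p + 4) + 1 - 6 = 2 * (p + 1) + 1 by omega,
    show 2 * (p + 4) + 1 - 7 = 2 * (p + 1) by omega,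
    show 2 * (p + 4) + 1 - 8 = 2 * p + 1 by omega,
    show 2 * (p + 4) + 1 - 9 = 2 * p by omega] at hc
  simp only [hw, coeff_invOneSubSq_pow_odd, coeff_invOneSubSq_pow_even] at hc
  rw [show 2 * p + 9 = 2 * (p + 4) + 1 by ring, ← hc, show 4 * p + 26 + (p + 4) = 5 * p + 30 by ring,
    show 4 * p + 26 + (p + 3) = 5 * p + 29 by ring, show 4 * p + 26 + (p + 2) = 5 * p + 28 by ring,
    show 4 * p + 26 + (p + 1) = 5 * p + 27 by ring, show 4 * p + 26 + p = 5 * p + 26 by ring]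
  -- The X^10 term is out of range for p = 0 and vanishes by parity for p ≥ 1.
  split_ifs with h10
  · obtain ⟨q, rfl⟩ : ∃ q, p = q + 1 := ⟨p - 1, by omega⟩
    rw [show 2 * (q + 1 + 4) + 1 - 10 = 2 * q + 1 by omega, coeff_invOneSubSq_pow_odd]
    ring
  · ring

/-- Inversion expresses d_m = 4 c_{2m} through b_m, and d_{m+1} = -256 c_{2m-1} through b_m and
b_{m+1}. Eliminating b_m, whose factor in the second relation is 4m, leaves b_{m+1}. -/
theorem _root_.IsEnumeratorSeq.shadowPoly_coeff_add_one (h : IsEnumeratorSeq (p + 5) c) :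
    (shadowPoly (p + 5) (shadowCoeff (p + 5) c)).coeff (p + 6) =
      -256 * c (2 * p + 9) - 4 * (p + 5) * (4 * c (2 * (p + 5)) - (5 * p + 25).choose (4 * p + 20) -
        (5 * p + 24).choose (4 * p + 20)) - (5 * p + 24).choose (4 * p + 18) -
        (5 * p + 23).choose (4 * p + 18) := by
  set d := shadowCoeff (p + 5) c with hd
  have hgap := coeff_mul_of_gap (m := p + 5) (by omega) (F := (shadowPoly (p + 5) d : ℚ⟦X⟧))
    (by rw [Polynomial.coeff_coe]; exact h.2.2.1)
    (fun j h1 h2 => by rw [Polynomial.coeff_coe]; exact h.2.2.2 j h1 h2)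
  have h1 := shadowSeq_eq_coeff (m := p + 5) (i := p + 5) (by omega) d
  have h2 := shadowSeq_eq_coeff (m := p + 5) (i := p + 5 + 1) (by omega) d
  rw [(hgap _).2.1, show 6 * (p + 5) - 2 * (p + 5) + 1 = 4 * p + 20 + 1 by omega,
    coeff_shadowKernel, coeff_zero_shadowKernel, Polynomial.coeff_coe] at h1
  rw [(hgap _).2.2, show 6 * (p + 5) - 2 * (p + 5 + 1) + 1 = 4 * p + 18 + 1 by omega,
    coeff_shadowKernel, coeff_shadowKernel _ 0, coeff_zero_shadowKernel, Polynomial.coeff_coe,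
    Polynomial.coeff_coe] at h2
  have d1 : d (p + 5) = 4 * c (2 * (p + 5)) := by
    rw [hd, shadowCoeff, show 3 * (p + 5) - (p + 5) = 2 * (p + 5) by omega, pow_mul]
    have : (2 : ℤ) + 6 * ((p + 5 : ℕ) : ℤ) - 6 * ((p + 5 : ℕ) : ℤ) = 2 := by ring
    rw [this]; norm_num; ring
  have d2 : d (p + 5 + 1) = -256 * c (2 * p + 9) := by
    rw [hd, shadowCoeff, show 3 * (p + 5) - (p + 5 + 1) = 2 * (p + 4) + 1 by omega, pow_succ, pow_mul]
    have : (2 : ℤ) + 6 * ((p + 5 + 1 : ℕ) : ℤ) - 6 * ((p + 5 : ℕ) : ℤ) = 8 := by push_cast; ring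
    rw [this, show 2 * (p + 4) + 1 = 2 * p + 9 by ring]; norm_num; ring
  rw [d1, show 4 * p + 20 + (p + 4 + 1) = 5 * p + 25 by ring,
    show 4 * p + 20 + (p + 4) = 5 * p + 24 by ring] at h1
  rw [d2, show 4 * p + 18 + (p + 5 + 1) = 5 * p + 24 by ring,
    show 4 * p + 18 + (p + 5) = 5 * p + 23 by ring] at h2
  rw [show p + 5 + 1 = p + 6 by ring] at h2
  have hch : ((4 * p + 18 + (0 + 1)).choose (4 * p + 18) : ℚ) = 4 * p + 19 := by
    rw [zero_add, Nat.choose_succ_self_right]; push_cast; ring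
  rw [hch, add_zero, Nat.choose_self] at h2
  push_cast at h2
  linear_combination h2 - 4 * (p + 5) * h1

end PowerSeries

/-! ### Negativity of b_{m+1} for m ≥ 175. -/

/-- Binomials with nearby parameters share the factor F = A!/(B! P!), leaving products of a few
consecutive integers. Thus the sign of a combination of them becomes the sign of a polynomial. -/
theorem exists_choose_ratio (A B P : ℕ) : ∃ F : ℚ, 0 < F ∧
    ∀ a b r s t q : ℕ, a = A + r → B = b + s → P = q + t → a = b + q →
      (a.choose b : ℚ) = F * ((A + 1).ascFactorial r * (b + 1).ascFactorial s *
        (q + 1).ascFactorial t : ℕ) := by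
  refine ⟨(A.factorial : ℚ) / (B.factorial * P.factorial), by positivity, ?_⟩
  rintro a b r s t q rfl rfl rfl h
  rw [Nat.cast_choose ℚ (by omega), show A + r - b = q by omega, ← Nat.factorial_mul_ascFactorial A,
    ← Nat.factorial_mul_ascFactorial b, ← Nat.factorial_mul_ascFactorial q]
  have h1 : ((b + 1).ascFactorial s : ℚ) ≠ 0 := by
    exact_mod_cast (Nat.ascFactorial_pos _ _).ne'
  have h2 : ((q + 1).ascFactorial t : ℚ) ≠ 0 := by
    exact_mod_cast (Nat.ascFactorial_pos _ _).ne'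
  push_cast
  field_simp

/-- For `m = p + 5 ≥ 175` the coefficient `b_{m+1}` is negative. -/
theorem IsEnumeratorSeq.shadowPoly_coeff_neg {p : ℕ} {c : ℕ → ℚ} (hp : 170 ≤ p)
    (h : IsEnumeratorSeq (p + 5) c) :
    (shadowPoly (p + 5) (shadowCoeff (p + 5) c)).coeff (p + 6) < 0 := by
  rw [h.shadowPoly_coeff_add_one, h.apply_two_mul, h.apply_two_mul_sub_one]
  -- These two binomials enter with a minus sign, so nonnegativity suffices for them.
  have n1 : (0 : ℚ) ≤ (5 * p + 24).choose (4 * p + 18) := Nat.cast_nonneg _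
  have n2 : (0 : ℚ) ≤ (5 * p + 23).choose (4 * p + 18) := Nat.cast_nonneg _
  -- The smallest upper index and the largest lower and complementary indices among the other
  -- binomials.
  obtain ⟨F, hFpos, hF⟩ := exists_choose_ratio (5 * p + 24) (4 * p + 26) (p + 5)
  rw [hF (5 * p + 30) (4 * p + 26) 6 0 1 (p + 4) rfl rfl rfl (by ring),
    hF (5 * p + 29) (4 * p + 26) 5 0 2 (p + 3) rfl rfl rfl (by ring),
    hF (5 * p + 28) (4 * p + 26) 4 0 3 (p + 2) rfl rfl rfl (by ring),
    hF (5 * p + 27) (4 * p + 26) 3 0 4 (p + 1) rfl rfl rfl (by ring),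
    hF (5 * p + 26) (4 * p + 26) 2 0 5 p rfl rfl rfl (by ring),
    hF (5 * p + 27) (4 * p + 22) 3 4 0 (p + 5) rfl rfl rfl (by ring),
    hF (5 * p + 26) (4 * p + 22) 2 4 1 (p + 4) rfl rfl rfl (by ring),
    hF (5 * p + 25) (4 * p + 22) 1 4 2 (p + 3) rfl rfl rfl (by ring),
    hF (5 * p + 25) (4 * p + 20) 1 6 0 (p + 5) rfl rfl rfl (by ring),
    hF (5 * p + 24) (4 * p + 20) 0 6 1 (p + 4) rfl rfl rfl (by ring)]
  obtain ⟨q, rfl⟩ : ∃ q, p = q + 170 := ⟨p - 170, by omega⟩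
  simp only [Nat.ascFactorial_succ, Nat.ascFactorial_zero]
  push_cast
  have hq : (0 : ℚ) ≤ q := Nat.cast_nonneg q
  generalize (q : ℚ) = x at *
  -- Apart from the two discarded binomials this is -b_{m+1}; after the shift p = q + 170 every
  -- coefficient is positive.
  have hP : 0 < F * (3581547696603475200000 * x ^ 0 + 9555210288608854128000 * x ^ 1 + 378799101438566593280 * x ^ 2 + 6472677850895401856 * x ^ 3 + 61533461579016704 * x ^ 4 + 351188691069440 * x ^ 5 + 1202946775040 * x ^ 6 + 2289557504 * x ^ 7 + 1867776 * x ^ 8) := by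
    positivity
  linarith

/-! ### Fast evaluation of binary forms with natural coefficients. -/

/-- `f n`, arranged so that reduction in the kernel evaluates `n` first. -/
def forceNat {α : Type} (n : ℕ) (f : ℕ → α) : α :=
  Nat.rec (f 0) (fun k _ => f (Nat.succ k)) n

@[simp] theorem forceNat_eq {α : Type} (n : ℕ) (f : ℕ → α) : forceNat n f = f n := by
  cases n <;> rfl

/-- The form `∑_j l_j X ^ (L - 1 - j) * Y ^ j`, where `L` is the length of `l`. -/
def homForm {R : Type*} [CommSemiring R] : List ℕ → R → R → R
  | [], _, _ => 0
  | a :: l, X, Y => a * X ^ l.length + Y * homForm l X Y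

/-- Replace consecutive entries `a, b` by `a * X + b * Y`. -/
def pairUp (X Y : ℕ) : List ℕ → List ℕ
  | a :: b :: l => forceNat (a * X + b * Y) fun c => c :: pairUp X Y l
  | l => l

/-- Evaluation of `homForm` by pairing consecutive terms. -/
def evalHom : ℕ → List ℕ → ℕ → ℕ → ℕ
  | 0, _, _, _ => 0
  | f + 1, l, X, Y =>
    match l with
    | [] => 0
    | [a] => a
    | a :: b :: t =>
      match t.length % 2 with
      | 0 => forceNat (X * X) fun X' => forceNat (Y * Y) fun Y' =>
          evalHom f (pairUp X Y (a :: b :: t)) X' Y'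
      | _ + 1 => a * X ^ (t.length + 1) + Y *
        forceNat (X * X) fun X' => forceNat (Y * Y) fun Y' => evalHom f (pairUp X Y (b :: t)) X' Y'

theorem two_mul_length_pairUp (X Y : ℕ) :
    ∀ l : List ℕ, l.length % 2 = 0 → 2 * (pairUp X Y l).length = l.length
  | [], _ => rfl
  | [_], h => by simp at h
  | a :: b :: l, h => by
    have := two_mul_length_pairUp X Y l (by simpa [Nat.add_assoc] using h)
    simp only [pairUp, forceNat_eq, List.length_cons]
    omega

theorem homForm_pairUp (X Y : ℕ) :
    ∀ l : List ℕ, l.length % 2 = 0 → homForm (pairUp X Y l) (X * X) (Y * Y) = homForm l X Y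
  | [], _ => rfl
  | [_], h => by simp at h
  | a :: b :: l, h => by
    have hl : l.length % 2 = 0 := by simpa [Nat.add_assoc] using h
    have h1 := homForm_pairUp X Y l hl
    have h2 := two_mul_length_pairUp X Y l hl
    simp only [pairUp, forceNat_eq, homForm, h1, List.length_cons, ← h2, Nat.cast_id]
    ring

theorem evalHom_eq (f : ℕ) :
    ∀ (l : List ℕ) (X Y : ℕ), l.length ≤ f → evalHom f l X Y = homForm l X Y := by
  induction f with
  | zero =>
    intro l X Y h
    rw [List.length_eq_zero_iff.1 (Nat.le_zero.1 h)]; rfl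
  | succ f ih =>
    intro l X Y h
    match l, h with
    | [], _ => rfl
    | [a], _ => simp [evalHom, homForm]
    | a :: b :: t, h =>
      simp only [List.length_cons] at h
      simp only [evalHom]
      split
      · next h0 =>
        have h2 : (a :: b :: t).length % 2 = 0 := by simp only [List.length_cons]; omega
        have h3 := two_mul_length_pairUp X Y _ h2
        simp only [List.length_cons] at h3
        rw [forceNat_eq, forceNat_eq, ih _ _ _ (by omega), homForm_pairUp X Y _ h2]
      · next h0 =>
        have h2 : (b :: t).length % 2 = 0 := by simp only [List.length_cons]; omega
        have h3 := two_mul_length_pairUp X Y _ h2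
        simp only [List.length_cons] at h3
        rw [forceNat_eq, forceNat_eq, ih _ _ _ (by omega), homForm_pairUp X Y _ h2]
        rfl

theorem map_homForm {R R' F : Type*} [CommSemiring R] [CommSemiring R'] [FunLike F R R']
    [RingHomClass F R R'] (φ : F) (X Y : R) :
    ∀ l : List ℕ, φ (homForm l X Y) = homForm l (φ X) (φ Y)
  | [] => map_zero φ
  | a :: l => by simp [homForm, map_homForm φ X Y l]

theorem homForm_eq_sum {R : Type*} [CommSemiring R] (X Y : R) : ∀ l : List ℕ,
    homForm l X Y = ∑ j ∈ Finset.range l.length,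
      ((l.getD j 0 : ℕ) : R) * X ^ (l.length - 1 - j) * Y ^ j
  | [] => rfl
  | a :: l => by
    rw [homForm, homForm_eq_sum X Y l, List.length_cons, Finset.sum_range_succ', Finset.mul_sum,
      add_comm]
    congr 1
    · refine Finset.sum_congr rfl fun j _ => ?_
      rw [List.getD_cons_succ, show l.length + 1 - 1 - (j + 1) = l.length - 1 - j by omega]
      ring
    · simp

theorem natDegree_homForm_le {X Y : ℤ[X]} {d : ℕ} (hX : X.natDegree ≤ d) (hY : Y.natDegree ≤ d) :
    ∀ l : List ℕ, (homForm l X Y).natDegree ≤ d * (l.length - 1)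
  | [] => by simp [homForm]
  | [a] => by simp [homForm]
  | a :: b :: l => by
    have := natDegree_homForm_le hX hY (b :: l)
    rw [homForm]
    refine (natDegree_add_le _ _).trans (max_le ?_ ?_)
    · refine natDegree_mul_le.trans ?_
      rw [natDegree_natCast, zero_add]
      exact natDegree_pow_le.trans (by rw [mul_comm]; exact Nat.mul_le_mul_right _ hX)
    · refine natDegree_mul_le.trans ?_
      simp only [List.length_cons, Nat.add_sub_cancel] at this ⊢
      nlinarith

/-! ### Coefficient bounds by majorants. -/

/-- `Q` bounds the coefficients of `P` in absolute value. -/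
def CoeffBound (P Q : ℤ[X]) : Prop := ∀ i, |P.coeff i| ≤ Q.coeff i

theorem CoeffBound.add {P Q P' Q' : ℤ[X]} (h : CoeffBound P Q) (h' : CoeffBound P' Q') :
    CoeffBound (P + P') (Q + Q') := fun i => by
  rw [coeff_add, coeff_add]
  exact (abs_add_le _ _).trans (add_le_add (h i) (h' i))

theorem CoeffBound.mul {P Q P' Q' : ℤ[X]} (h : CoeffBound P Q) (h' : CoeffBound P' Q') :
    CoeffBound (P * P') (Q * Q') := fun i => by
  rw [coeff_mul, coeff_mul]
  refine (Finset.abs_sum_le_sum_abs _ _).trans (Finset.sum_le_sum fun x _ => ?_)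
  rw [abs_mul]
  exact mul_le_mul (h _) (h' _) (abs_nonneg _) ((abs_nonneg _).trans (h _))

theorem CoeffBound.neg {P Q : ℤ[X]} (h : CoeffBound P Q) : CoeffBound (-P) Q := fun i => by
  rw [coeff_neg, abs_neg]; exact h i

theorem CoeffBound.natCast (a : ℕ) : CoeffBound (a : ℤ[X]) (a : ℤ[X]) := fun i => by
  rw [abs_of_nonneg]
  rw [← C_eq_natCast, coeff_C]
  split_ifs <;> simp

theorem CoeffBound.X : CoeffBound (X : ℤ[X]) X := fun i => by
  rw [coeff_X]; split_ifs <;> simp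

theorem CoeffBound.one : CoeffBound (1 : ℤ[X]) 1 := by simpa using CoeffBound.natCast 1

theorem CoeffBound.pow {P Q : ℤ[X]} (h : CoeffBound P Q) (n : ℕ) :
    CoeffBound (P ^ n) (Q ^ n) := by
  induction n with
  | zero => simpa using CoeffBound.one
  | succ n ih => rw [pow_succ, pow_succ]; exact ih.mul h

theorem CoeffBound.homForm {P Q P' Q' : ℤ[X]} (h : CoeffBound P Q) (h' : CoeffBound P' Q') :
    ∀ l : List ℕ, CoeffBound (homForm l P P') (homForm l Q Q')
  | [] => fun i => by simp [_root_.homForm]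
  | a :: l => ((CoeffBound.natCast a).mul (h.pow _)).add (h'.mul (CoeffBound.homForm h h' l))

theorem CoeffBound.abs_coeff_le {P Q : ℤ[X]} (h : CoeffBound P Q) (i : ℕ) :
    |P.coeff i| ≤ Q.eval 1 := by
  have h0 : ∀ j, 0 ≤ Q.coeff j := fun j => (abs_nonneg _).trans (h j)
  refine (h i).trans ?_
  rw [eval_eq_sum_range' (Nat.lt_succ_of_le (le_max_left Q.natDegree i))]
  simp only [one_pow, mul_one]
  exact Finset.single_le_sum (f := fun j => Q.coeff j) (fun j _ => h0 j)
    (Finset.mem_range.2 (Nat.lt_succ_of_le (le_max_right _ _)))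

theorem eq_zero_of_pow_dvd_sum {T : ℤ} (L : ℕ) : ∀ (g : ℕ → ℤ) (n : ℕ), L ≤ n →
    (∀ i, |g i| < T) → T ^ L ∣ ∑ i ∈ Finset.range n, g i * T ^ i → ∀ i < L, g i = 0 := by
  induction L with
  | zero => intro _ _ _ _ _ i hi; omega
  | succ L ih =>
    intro g n hn hg hd
    obtain ⟨n, rfl⟩ : ∃ n', n = n' + 1 := ⟨n - 1, by omega⟩
    have hT : 0 < T := (abs_nonneg _).trans_lt (hg 0)
    have hs : ∑ i ∈ Finset.range (n + 1), g i * T ^ i =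
        T * ∑ i ∈ Finset.range n, g (i + 1) * T ^ i + g 0 := by
      rw [Finset.sum_range_succ', Finset.mul_sum, pow_zero, mul_one]
      congr 1
      exact Finset.sum_congr rfl fun i _ => by ring
    rw [hs] at hd
    have h0 : g 0 = 0 := by
      refine Int.eq_zero_of_abs_lt_dvd ?_ (hg 0)
      exact (dvd_add_right (dvd_mul_right _ _)).1 ((dvd_pow_self T (Nat.succ_ne_zero L)).trans hd)
    rw [h0, add_zero, pow_succ', mul_dvd_mul_iff_left hT.ne'] at hd
    have := ih (fun i => g (i + 1)) n (by omega) (fun i => hg _) hd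
    intro i hi
    rcases i with _ | i
    · exact h0
    · exact this i (by omega)

theorem testBit_digit_sum {k : ℕ} (hk : 1 ≤ k) (n : ℕ) : ∀ (q : ℕ → ℕ) (i : ℕ),
    (∀ i, q i < 2 ^ k) → i < n →
    (∑ i ∈ Finset.range n, q i * (2 ^ k) ^ i).testBit (k * i + (k - 1)) =
      decide (2 ^ (k - 1) ≤ q i) := by
  induction n with
  | zero => intro _ _ _ h; omega
  | succ n ih =>
    intro q i hq hi
    have hs : ∑ i ∈ Finset.range (n + 1), q i * (2 ^ k) ^ i =
        2 ^ k * ∑ i ∈ Finset.range n, q (i + 1) * (2 ^ k) ^ i + q 0 := by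
      rw [Finset.sum_range_succ', Finset.mul_sum, pow_zero, mul_one]
      congr 1
      exact Finset.sum_congr rfl fun i _ => by ring
    rw [hs, Nat.testBit_two_pow_mul_add _ (hq 0)]
    rcases i with _ | i
    · rw [if_pos (by omega), mul_zero, zero_add]
      by_cases h : 2 ^ (k - 1) ≤ q 0
      · simp only [h, decide_true]
        refine Nat.testBit_of_two_pow_le_and_two_pow_add_one_gt h ?_
        rw [Nat.sub_add_cancel hk]; exact hq 0
      · simp only [h, decide_false]
        exact Nat.testBit_lt_two_pow (not_le.1 h)
    · rw [if_neg (by nlinarith), show k * (i + 1) + (k - 1) - k = k * i + (k - 1) by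
        rw [mul_add, mul_one]; omega]
      exact ih (fun i => q (i + 1)) i (fun i => hq _) (by omega)

/-- `∑_{i < n} B ^ i`, computed by one division. -/
def geomSumDiv (B n : ℕ) : ℕ := (B ^ n - 1) / (B - 1)

theorem geomSumDiv_eq {B : ℕ} (hB : 2 ≤ B) (n : ℕ) :
    geomSumDiv B n = ∑ i ∈ Finset.range n, B ^ i :=
  (Nat.geomSum_eq hB n).symm

theorem sum_alternating {T : ℕ} (hT : 2 ≤ T) (a b n : ℕ) :
    ∑ i ∈ Finset.range (2 * n + 1), (if i % 2 = 0 then a else b) * T ^ i =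
      a * geomSumDiv (T ^ 2) (n + 1) + b * (T * geomSumDiv (T ^ 2) n) := by
  have hB : 2 ≤ T ^ 2 := by nlinarith
  rw [geomSumDiv_eq hB, geomSumDiv_eq hB]
  induction n with
  | zero => simp
  | succ n ih =>
    rw [show 2 * (n + 1) + 1 = 2 * n + 1 + 1 + 1 by ring, Finset.sum_range_succ,
      Finset.sum_range_succ, ih, if_neg (by omega), if_pos (by omega),
      Finset.sum_range_succ _ (n + 1), Finset.sum_range_succ _ n]
    ring

theorem sum_constant {T : ℕ} (hT : 2 ≤ T) (a n : ℕ) :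
    ∑ i ∈ Finset.range n, a * T ^ i = a * geomSumDiv T n := by
  rw [geomSumDiv_eq hT, Finset.mul_sum]

/-! ### The certificate for small m and its soundness. -/

/-- `∑ e_j (1 + t) ^ (12 m + 2 - 4 j) (-t (1 - t) ^ 2) ^ j` with integer coefficients. -/
noncomputable def codeInt (E : List ℕ) : ℤ[X] :=
  (1 + X) ^ 2 * homForm E ((1 + X) ^ 4) (-(X * (1 - X) ^ 2))

/-- `∑ d_k (1 - u) ^ (6 m - 2 k) u ^ k` with integer coefficients. -/
noncomputable def shadowInt (D : List ℕ) : ℤ[X] := homForm D ((1 - X) ^ 2) X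

/-- The value at t = -T: since c_j = (-1)^j e_j, all summands are then nonnegative, so
natural-number arithmetic suffices. -/
def codeValue (E : List ℕ) (f T : ℕ) : ℕ :=
  (T - 1) ^ 2 * evalHom f E ((T - 1) ^ 4) (T * (T + 1) ^ 2)

def shadowValue (D : List ℕ) (f T : ℕ) : ℕ := evalHom f D ((T - 1) ^ 2) T

/-- `l_i * s * 64 ^ i = l'_i * t` for all `i`. -/
def scaledEq : ℕ → ℕ → List ℕ → List ℕ → Bool
  | _, _, [], [] => true
  | s, t, a :: l, b :: l' =>
    Nat.beq (a * s) (b * t) && forceNat (s * 64) fun s' => scaledEq s' t l l'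
  | _, _, _, _ => false

/-- `V ≡ 1` modulo `T ^ L`, for `T` a power of two. -/
def oneModPow (T L V : ℕ) : Bool := Nat.beq (Nat.land V (T ^ L - 1)) 1

/-- The conditions under which `E` and `D` list the coefficients of an enumerator pair, where
`V`, `U` are the values of the enumerators at `-T` and `T = 2 ^ k`. -/
def enumeratorCheck (m k : ℕ) (E D : List ℕ) (T V U : ℕ) : Bool :=
  Nat.beq E.length (3 * m + 1) && (scaledEq 4 (2 ^ (6 * m)) E.reverse D &&
  (Nat.blt (4 * evalHom (3 * m + 1) E 16 4) (2 ^ (k - 1)) &&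
  (Nat.blt (evalHom (3 * m + 1) D 4 1) (2 ^ (k - 1)) &&
  (oneModPow T (2 * m + 1) V && oneModPow T m U))))

/-- All base `T = 2 ^ k` digits of `U` and of `V`, with alternating signs for `V`, are
nonnegative. -/
def nonnegCheck (m k : ℕ) (T V U : ℕ) : Bool :=
  (forceNat (2 ^ (k - 1)) fun h =>
    forceNat (geomSumDiv (T ^ 2) (6 * m + 2)) fun e =>
    forceNat (T * geomSumDiv (T ^ 2) (6 * m + 1)) fun o =>
    Nat.beq (Nat.land (V + (h * e + (h - 1) * o)) (h * e + h * o)) (h * e)) &&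
  (forceNat (2 ^ (k - 1) * geomSumDiv T (6 * m + 1)) fun r => Nat.beq (Nat.land (U + r) r) r)

/-- The base `T = 2 ^ k` digit of `V` at the even index `i` is negative. -/
def negCheck (m k i : ℕ) (T V : ℕ) : Bool :=
  (forceNat (2 ^ (k - 1)) fun h =>
    forceNat (geomSumDiv (T ^ 2) (6 * m + 2)) fun e =>
    forceNat (T * geomSumDiv (T ^ 2) (6 * m + 1)) fun o =>
    Nat.beq (Nat.land (V + (h * e + (h - 1) * o)) (2 ^ (k * i + (k - 1)))) 0)

/-- The sequence `c` with alternating signs and absolute values listed by `E`. -/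
def signedSeq (E : List ℕ) (j : ℕ) : ℚ := (-1) ^ j * (E.getD j 0 : ℕ)

theorem scaledEq_iff : ∀ (s t : ℕ) (l l' : List ℕ), scaledEq s t l l' = true →
    l.length = l'.length ∧ ∀ i, l.getD i 0 * (s * 64 ^ i) = l'.getD i 0 * t
  | _, _, [], [], _ => by simp
  | s, t, a :: l, b :: l', h => by
    simp only [scaledEq, forceNat_eq, Bool.and_eq_true, Nat.beq_eq] at h
    obtain ⟨h1, h2⟩ := scaledEq_iff _ _ l l' h.2
    refine ⟨by simp [h1], fun i => ?_⟩
    rcases i with _ | i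
    · simpa using h.1
    · rw [List.getD_cons_succ, List.getD_cons_succ, ← h2 i]; ring
  | _, _, [], _ :: _, h => by simp [scaledEq] at h
  | _, _, _ :: _, [], h => by simp [scaledEq] at h

theorem codePoly_signedSeq {m : ℕ} {E : List ℕ} (hE : E.length = 3 * m + 1) :
    codePoly m (signedSeq E) = (codeInt E).map (Int.castRingHom ℚ) := by
  have := map_homForm (mapRingHom (Int.castRingHom ℚ)) ((1 + X) ^ 4) (-(X * (1 - X) ^ 2)) E
  simp only [coe_mapRingHom] at this
  rw [codeInt, Polynomial.map_mul, this, homForm_eq_sum, hE, codePoly, Finset.mul_sum]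
  refine Finset.sum_congr rfl fun j hj => ?_
  have hj : j ≤ 3 * m := Nat.lt_succ_iff.1 (Finset.mem_range.1 hj)
  rw [show 12 * m + 2 - 4 * j = 2 + 4 * (3 * m + 1 - 1 - j) by omega]
  simp only [signedSeq, Polynomial.map_pow, Polynomial.map_add, Polynomial.map_one, map_X,
    Polynomial.map_neg, Polynomial.map_mul, Polynomial.map_sub, C_mul, C_pow, C_neg, C_1,
    ← C_eq_natCast, ← pow_mul, pow_add, neg_pow (X * (1 - X : ℚ[X]) ^ 2)]
  ring

theorem shadowPoly_signedSeq {m : ℕ} {E D : List ℕ} (hE : E.length = 3 * m + 1)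
    (h : scaledEq 4 (2 ^ (6 * m)) E.reverse D = true) :
    shadowPoly m (shadowCoeff m (signedSeq E)) = (shadowInt D).map (Int.castRingHom ℚ) := by
  obtain ⟨hl, hs⟩ := scaledEq_iff _ _ _ _ h
  rw [List.length_reverse, hE] at hl
  have := map_homForm (mapRingHom (Int.castRingHom ℚ)) ((1 - X) ^ 2) X D
  simp only [coe_mapRingHom] at this
  rw [shadowInt, this, homForm_eq_sum, ← hl, shadowPoly]
  refine Finset.sum_congr rfl fun k hk => ?_
  have hk : k ≤ 3 * m := Nat.lt_succ_iff.1 (Finset.mem_range.1 hk)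
  have hc : shadowCoeff m (signedSeq E) k = (D.getD k 0 : ℕ) := by
    have h1 := hs k
    have h2 : E.reverse.getD k 0 = E.getD (3 * m - k) 0 := by
      rw [List.getD_eq_getElem _ _ (by simp [hE]; omega),
        List.getD_eq_getElem _ _ (by omega), List.getElem_reverse]
      congr 1
      omega
    rw [h2] at h1
    have h3 : ((E.getD (3 * m - k) 0 : ℕ) : ℚ) * (4 * 64 ^ k) = (D.getD k 0 : ℕ) * 2 ^ (6 * m) := by
      exact_mod_cast h1
    have h4 : (2 : ℚ) ^ ((2 : ℤ) + 6 * k - 6 * m) = 4 * 64 ^ k / 2 ^ (6 * m) := by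
      rw [zpow_sub₀ two_ne_zero, zpow_add₀ two_ne_zero]
      have e1 : (2 : ℚ) ^ (6 * (k : ℤ)) = 64 ^ k := by
        rw [zpow_mul, zpow_natCast]; norm_num
      have e2 : (2 : ℚ) ^ (6 * (m : ℤ)) = 2 ^ (6 * m) := by
        rw [← zpow_natCast]; norm_num
      rw [e1, e2]; norm_num
    have hsq : ((-1 : ℚ) ^ (3 * m - k)) * (-1) ^ (3 * m - k) = 1 := by
      rw [← mul_pow]; norm_num
    rw [shadowCoeff, signedSeq, ← mul_assoc, hsq, one_mul, h4, mul_div_assoc', h3,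
      mul_div_assoc, div_self (by positivity), mul_one]
  rw [hc, show 3 * m + 1 - 1 - k = 3 * m - k by omega,
    show 6 * m - 2 * k = 2 * (3 * m - k) by omega, pow_mul]
  simp only [Polynomial.map_pow, Polynomial.map_one, map_X, Polynomial.map_sub, ← C_eq_natCast]
  ring

theorem codeInt_eval {E : List ℕ} {f T : ℕ} (hf : E.length ≤ f) (hT : 1 ≤ T) :
    (codeInt E).eval (-(T : ℤ)) = codeValue E f T := by
  have := map_homForm (evalRingHom (-(T : ℤ))) ((1 + X) ^ 4) (-(X * (1 - X) ^ 2)) E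
  simp only [coe_evalRingHom] at this
  have h2 := map_homForm (Nat.castRingHom ℤ) ((T - 1) ^ 4) (T * (T + 1) ^ 2) E
  simp only [eq_natCast] at h2
  rw [codeInt, eval_mul, this, codeValue, evalHom_eq _ _ _ _ hf, Nat.cast_mul, h2]
  push_cast [Nat.cast_sub hT]
  simp only [eval_pow, eval_add, eval_one, eval_X, eval_neg, eval_mul, eval_sub]
  congr 1
  · ring
  · congr 1 <;> ring

theorem shadowInt_eval {D : List ℕ} {f T : ℕ} (hf : D.length ≤ f) (hT : 1 ≤ T) :
    (shadowInt D).eval (T : ℤ) = shadowValue D f T := by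
  have := map_homForm (evalRingHom (T : ℤ)) ((1 - X) ^ 2) X D
  simp only [coe_evalRingHom] at this
  have h2 := map_homForm (Nat.castRingHom ℤ) ((T - 1) ^ 2) T D
  simp only [eq_natCast] at h2
  rw [shadowInt, this, shadowValue, evalHom_eq _ _ _ _ hf, h2]
  push_cast [Nat.cast_sub hT]
  simp only [eval_pow, eval_one, eval_X, eval_sub]
  congr 1
  ring

/-- Replacing every minus sign by plus gives a majorant, whose value at 1 has (1+X)^2 = 4, (1+X)^4 =
16 and X(1+X)^2 = 4. -/
theorem abs_codeInt_coeff_le {E : List ℕ} {f : ℕ} (hf : E.length ≤ f) (i : ℕ) :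
    |(codeInt E).coeff i| ≤ ((4 * evalHom f E 16 4 : ℕ) : ℤ) := by
  have h1 : CoeffBound (1 + X : ℤ[X]) (1 + X) := CoeffBound.one.add CoeffBound.X
  have h2 : CoeffBound (1 - X : ℤ[X]) (1 + X) := by
    rw [sub_eq_add_neg]; exact CoeffBound.one.add CoeffBound.X.neg
  have h := ((h1.pow 2).mul ((h1.pow 4).homForm ((CoeffBound.X.mul (h2.pow 2)).neg) E)).abs_coeff_le i
  have := map_homForm (evalRingHom (1 : ℤ)) ((1 + X) ^ 4) (X * (1 + X) ^ 2) E
  simp only [coe_evalRingHom] at this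
  have h3 := map_homForm (Nat.castRingHom ℤ) 16 4 E
  simp only [eq_natCast] at h3
  rw [eval_mul, this] at h
  rw [evalHom_eq _ _ _ _ hf, Nat.cast_mul, h3]
  simp only [eval_pow, eval_add, eval_one, eval_X, eval_mul] at h
  norm_num at h ⊢
  exact h

theorem abs_shadowInt_coeff_le {D : List ℕ} {f : ℕ} (hf : D.length ≤ f) (i : ℕ) :
    |(shadowInt D).coeff i| ≤ ((evalHom f D 4 1 : ℕ) : ℤ) := by
  have h2 : CoeffBound (1 - X : ℤ[X]) (1 + X) := by
    rw [sub_eq_add_neg]; exact CoeffBound.one.add CoeffBound.X.neg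
  have h := ((h2.pow 2).homForm CoeffBound.X D).abs_coeff_le i
  have := map_homForm (evalRingHom (1 : ℤ)) ((1 + X) ^ 2) X D
  simp only [coe_evalRingHom] at this
  have h3 := map_homForm (Nat.castRingHom ℤ) 4 1 D
  simp only [eq_natCast] at h3
  rw [this] at h
  rw [evalHom_eq _ _ _ _ hf, h3]
  simp only [eval_pow, eval_add, eval_one, eval_X] at h
  norm_num at h ⊢
  exact h

theorem natDegree_codeInt_lt {m : ℕ} {E : List ℕ} (hE : E.length = 3 * m + 1) :
    (codeInt E).natDegree < 12 * m + 3 := by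
  have h1 : ((1 + X : ℤ[X]) ^ 4).natDegree ≤ 4 := by compute_degree!
  have h2 : (-(X * (1 - X) ^ 2) : ℤ[X]).natDegree ≤ 4 := by compute_degree!
  have h3 : ((1 + X : ℤ[X]) ^ 2).natDegree ≤ 2 := by compute_degree!
  have h4 := natDegree_homForm_le h1 h2 E
  rw [hE] at h4
  have := natDegree_mul_le (p := (1 + X : ℤ[X]) ^ 2)
    (q := homForm E ((1 + X) ^ 4) (-(X * (1 - X) ^ 2)))
  rw [codeInt]
  omega

theorem natDegree_shadowInt_lt {m : ℕ} {D : List ℕ} (hD : D.length = 3 * m + 1) :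
    (shadowInt D).natDegree < 6 * m + 1 := by
  have h1 : ((1 - X : ℤ[X]) ^ 2).natDegree ≤ 2 := by compute_degree!
  have h2 : (X : ℤ[X]).natDegree ≤ 2 := by compute_degree!
  have h4 := natDegree_homForm_le h1 h2 D
  rw [hD] at h4
  rw [shadowInt]
  omega

/-- Subtracting 1 from V leaves a multiple of T^L whose signed digits are still smaller than T =
2^k, so `eq_zero_of_pow_dvd_sum` applies. -/
theorem coeff_of_oneModPow {k L n V : ℕ} (hk : 1 ≤ k) (hL : L ≤ n) {g : ℕ → ℤ}
    (hg : ∀ i, |g i| < 2 ^ (k - 1)) (hV : ∑ i ∈ Finset.range n, g i * ((2 ^ k : ℕ) : ℤ) ^ i = V)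
    (h : oneModPow (2 ^ k) L V = true) : ∀ i < L, g i = if i = 0 then 1 else 0 := by
  have hmod : V % 2 ^ (k * L) = 1 := by
    rw [oneModPow, Nat.beq_eq, ← pow_mul] at h
    rwa [← Nat.and_two_pow_sub_one_eq_mod]
  intro i hi
  have hn : 0 < n := by omega
  have hd : ((2 ^ k : ℕ) : ℤ) ^ L ∣
      ∑ i ∈ Finset.range n, (g i - if i = 0 then 1 else 0) * ((2 ^ k : ℕ) : ℤ) ^ i := by
    simp only [sub_mul, Finset.sum_sub_distrib, hV, ite_mul, zero_mul, one_mul]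
    rw [Finset.sum_ite_eq' , if_pos (Finset.mem_range.2 hn), pow_zero]
    have h1 : (2 ^ k) ^ L ∣ V - 1 := by
      rw [← pow_mul, ← hmod]; exact Nat.dvd_sub_mod V
    have h2 : 1 ≤ V := by
      by_contra h0
      rw [show V = 0 by omega] at hmod
      simp at hmod
    have := Int.natCast_dvd_natCast.2 h1
    rwa [Nat.cast_sub h2, Nat.cast_pow, Nat.cast_one] at this
  have hb : ∀ i, |g i - if i = 0 then 1 else 0| < ((2 ^ k : ℕ) : ℤ) := by
    intro i
    have h1 := hg i
    have h2 : ((2 ^ k : ℕ) : ℤ) = 2 * 2 ^ (k - 1) := by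
      rw [← pow_succ', Nat.sub_add_cancel hk]; norm_cast
    rw [h2]
    have h3 := abs_lt.1 h1
    rw [abs_lt]
    split_ifs <;> constructor <;> linarith
  have := eq_zero_of_pow_dvd_sum L _ n hL hb hd i hi
  linarith

theorem enumeratorCheck_sound {m k : ℕ} {E D : List ℕ} (hm : 1 ≤ m) (hk : 1 ≤ k)
    (h : enumeratorCheck m k E D (2 ^ k) (codeValue E (3 * m + 1) (2 ^ k))
      (shadowValue D (3 * m + 1) (2 ^ k)) = true) :
    IsEnumeratorSeq m (signedSeq E) ∧
    codePoly m (signedSeq E) = (codeInt E).map (Int.castRingHom ℚ) ∧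
    shadowPoly m (shadowCoeff m (signedSeq E)) = (shadowInt D).map (Int.castRingHom ℚ) ∧
    (∀ i, |(codeInt E).coeff i| < 2 ^ (k - 1)) ∧ (∀ i, |(shadowInt D).coeff i| < 2 ^ (k - 1)) ∧
    ∑ i ∈ Finset.range (12 * m + 3), (-1) ^ i * (codeInt E).coeff i * ((2 ^ k : ℕ) : ℤ) ^ i =
      (codeValue E (3 * m + 1) (2 ^ k) : ℕ) ∧
    ∑ i ∈ Finset.range (6 * m + 1), (shadowInt D).coeff i * ((2 ^ k : ℕ) : ℤ) ^ i =
      (shadowValue D (3 * m + 1) (2 ^ k) : ℕ) := by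
  simp only [enumeratorCheck, Bool.and_eq_true, Nat.beq_eq, Nat.blt_eq] at h
  obtain ⟨hE, hlink, hbE, hbD, hV, hU⟩ := h
  have hD : D.length = 3 * m + 1 := by
    rw [← (scaledEq_iff _ _ _ _ hlink).1, List.length_reverse, hE]
  have hT : 1 ≤ 2 ^ k := Nat.one_le_two_pow
  have b1 : ∀ i, |(codeInt E).coeff i| < 2 ^ (k - 1) := fun i =>
    (abs_codeInt_coeff_le hE.le i).trans_lt (by exact_mod_cast hbE)
  have b2 : ∀ i, |(shadowInt D).coeff i| < 2 ^ (k - 1) := fun i =>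
    (abs_shadowInt_coeff_le hD.le i).trans_lt (by exact_mod_cast hbD)
  have s1 : ∑ i ∈ Finset.range (12 * m + 3), (-1) ^ i * (codeInt E).coeff i *
      ((2 ^ k : ℕ) : ℤ) ^ i = (codeValue E (3 * m + 1) (2 ^ k) : ℕ) := by
    rw [← codeInt_eval hE.le hT, eval_eq_sum_range' (natDegree_codeInt_lt hE)]
    refine Finset.sum_congr rfl fun i _ => ?_
    rw [neg_pow ((2 ^ k : ℕ) : ℤ)]; ring
  have s2 : ∑ i ∈ Finset.range (6 * m + 1), (shadowInt D).coeff i * ((2 ^ k : ℕ) : ℤ) ^ i =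
      (shadowValue D (3 * m + 1) (2 ^ k) : ℕ) := by
    rw [← shadowInt_eval hD.le hT, eval_eq_sum_range' (natDegree_shadowInt_lt hD)]
  have p1 := codePoly_signedSeq hE
  have p2 := shadowPoly_signedSeq hE hlink
  have c1 := coeff_of_oneModPow hk (by omega) (fun i => by
    rw [abs_mul, abs_pow, abs_neg, abs_one, one_pow, one_mul]; exact b1 i) s1 hV
  have c2 := coeff_of_oneModPow hk (by omega) b2 s2 hU
  refine ⟨⟨?_, fun i h1 h2 => ?_, ?_, fun i h1 h2 => ?_⟩, p1, p2, b1, b2, s1, s2⟩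
  · rw [p1, coeff_map]
    have := c1 0 (by omega)
    simp only [pow_zero, one_mul, if_true] at this
    simp [this]
  · rw [p1, coeff_map]
    have := c1 i (by omega)
    rw [if_neg (by omega)] at this
    have : (codeInt E).coeff i = 0 := by simpa using this
    simp [this]
  · rw [p2, coeff_map, c2 0 (by omega)]; simp
  · rw [p2, coeff_map, c2 i h2, if_neg (by omega)]; simp

/-- An offset makes every digit nonnegative without carries, so its top bit reveals a sign. At odd i
the digit carries -g i; the offset 2^(k-1) - 1 there, rather than 2^(k-1), keeps the bit clear when
g i = 0. -/
theorem testBit_code {m k : ℕ} (hk : 1 ≤ k) {g : ℕ → ℤ} {V : ℕ} (hb : ∀ i, |g i| < 2 ^ (k - 1))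
    (hV : ∑ i ∈ Finset.range (12 * m + 3), (-1) ^ i * g i * ((2 ^ k : ℕ) : ℤ) ^ i = V)
    {i : ℕ} (hi : i < 12 * m + 3) :
    (V + (2 ^ (k - 1) * geomSumDiv ((2 ^ k) ^ 2) (6 * m + 2) +
      (2 ^ (k - 1) - 1) * (2 ^ k * geomSumDiv ((2 ^ k) ^ 2) (6 * m + 1)))).testBit
        (k * i + (k - 1)) = if i % 2 = 0 then decide (0 ≤ g i) else decide (g i < 0) := by
  have hT : 2 ≤ 2 ^ k := by simpa using Nat.pow_le_pow_right (n := 2) (by norm_num) hk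
  have hk2 : 2 ^ k = 2 * 2 ^ (k - 1) := by rw [← pow_succ', Nat.sub_add_cancel hk]
  have hpos : 1 ≤ 2 ^ (k - 1) := Nat.one_le_two_pow
  rw [← sum_alternating hT, show 2 * (6 * m + 1) + 1 = 12 * m + 3 by ring]
  set o : ℕ → ℕ := fun i => if i % 2 = 0 then 2 ^ (k - 1) else 2 ^ (k - 1) - 1 with ho
  have hq : ∀ i, (((-1) ^ i * g i + o i).toNat : ℤ) = (-1) ^ i * g i + o i := by
    intro i
    refine Int.toNat_of_nonneg ?_
    have := abs_lt.1 (hb i)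
    rcases Nat.even_or_odd i with h | h
    · simp only [ho, h.neg_one_pow, Nat.even_iff.1 h, if_true]; push_cast; linarith
    · simp only [ho, h.neg_one_pow, Nat.odd_iff.1 h, one_ne_zero, if_false]
      push_cast [Nat.cast_sub hpos]; linarith
  have hlt : ∀ i, ((-1) ^ i * g i + o i).toNat < 2 ^ k := by
    intro i
    zify
    rw [hq, show ((2 : ℤ) ^ k) = 2 * 2 ^ (k - 1) by exact_mod_cast hk2]
    have := abs_lt.1 (hb i)
    rcases Nat.even_or_odd i with h | h
    · simp only [ho, h.neg_one_pow, Nat.even_iff.1 h, if_true]; push_cast; linarith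
    · simp only [ho, h.neg_one_pow, Nat.odd_iff.1 h, one_ne_zero, if_false]
      push_cast [Nat.cast_sub hpos]; linarith
  have hsum : V + ∑ i ∈ Finset.range (12 * m + 3), o i * (2 ^ k) ^ i =
      ∑ i ∈ Finset.range (12 * m + 3), ((-1) ^ i * g i + o i).toNat * (2 ^ k) ^ i := by
    zify
    simp only [hq]
    rw [← hV, ← Finset.sum_add_distrib]
    refine Finset.sum_congr rfl fun i _ => ?_
    push_cast
    ring
  rw [hsum, testBit_digit_sum hk _ _ _ hlt hi]
  have := hq i
  have hz : (2 ^ (k - 1) ≤ ((-1) ^ i * g i + o i).toNat) ↔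
      ((2 : ℤ) ^ (k - 1) ≤ (-1) ^ i * g i + o i) := by
    rw [← hq i]; norm_cast
  simp only [hz]
  rcases Nat.even_or_odd i with h | h
  · simp [ho, h.neg_one_pow, Nat.even_iff.1 h]
  · simp only [ho, h.neg_one_pow, Nat.odd_iff.1 h, one_ne_zero, if_false]
    push_cast [Nat.cast_sub hpos]
    congr 1
    apply propext
    constructor <;> intro h <;> linarith

theorem testBit_shadow {n k : ℕ} (hk : 1 ≤ k) {g : ℕ → ℤ} {U : ℕ} (hb : ∀ i, |g i| < 2 ^ (k - 1))
    (hU : ∑ i ∈ Finset.range n, g i * ((2 ^ k : ℕ) : ℤ) ^ i = U)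
    {i : ℕ} (hi : i < n) :
    (U + 2 ^ (k - 1) * geomSumDiv (2 ^ k) n).testBit (k * i + (k - 1)) = decide (0 ≤ g i) := by
  have hT : 2 ≤ 2 ^ k := by simpa using Nat.pow_le_pow_right (n := 2) (by norm_num) hk
  have hk2 : 2 ^ k = 2 * 2 ^ (k - 1) := by rw [← pow_succ', Nat.sub_add_cancel hk]
  rw [← sum_constant hT]
  have hq : ∀ i, ((g i + (2 ^ (k - 1) : ℕ)).toNat : ℤ) = g i + (2 ^ (k - 1) : ℕ) := by
    intro i
    refine Int.toNat_of_nonneg ?_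
    have := abs_lt.1 (hb i)
    push_cast; linarith
  have hlt : ∀ i, (g i + (2 ^ (k - 1) : ℕ)).toNat < 2 ^ k := by
    intro i
    rw [← Nat.cast_lt (α := ℤ), hq, hk2]
    have := abs_lt.1 (hb i)
    push_cast; linarith
  have hsum : U + ∑ i ∈ Finset.range n, 2 ^ (k - 1) * (2 ^ k) ^ i =
      ∑ i ∈ Finset.range n, (g i + (2 ^ (k - 1) : ℕ)).toNat * (2 ^ k) ^ i := by
    rw [← Nat.cast_inj (R := ℤ)]
    simp only [Nat.cast_sum, Nat.cast_mul, Nat.cast_add, hq]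
    rw [← hU, ← Finset.sum_add_distrib]
    refine Finset.sum_congr rfl fun i _ => ?_
    push_cast
    ring
  rw [hsum, testBit_digit_sum hk _ _ _ hlt hi]
  have hz : (2 ^ (k - 1) ≤ (g i + (2 ^ (k - 1) : ℕ)).toNat) ↔
      ((2 : ℤ) ^ (k - 1) ≤ g i + (2 ^ (k - 1) : ℕ)) := by
    rw [← hq i]; norm_cast
  simp only [hz]
  simp

/-- One bitwise conjunction tests all signs at once: for V the sign bits must be set at even
positions and clear at odd ones, for U they must all be set. -/
theorem nonnegCheck_sound {m k V U : ℕ} (hk : 1 ≤ k) {f g : ℕ → ℤ}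
    (hf : ∀ i, |f i| < 2 ^ (k - 1)) (hg : ∀ i, |g i| < 2 ^ (k - 1))
    (hV : ∑ i ∈ Finset.range (12 * m + 3), (-1) ^ i * f i * ((2 ^ k : ℕ) : ℤ) ^ i = V)
    (hU : ∑ i ∈ Finset.range (6 * m + 1), g i * ((2 ^ k : ℕ) : ℤ) ^ i = U)
    (h : nonnegCheck m k (2 ^ k) V U = true) :
    (∀ i < 12 * m + 3, 0 ≤ f i) ∧ ∀ i < 6 * m + 1, 0 ≤ g i := by
  have hT : 2 ≤ 2 ^ k := by simpa using Nat.pow_le_pow_right (n := 2) (by norm_num) hk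
  have hk2 : 2 ^ (k - 1) < 2 ^ k := Nat.pow_lt_pow_right (by norm_num) (by omega)
  simp only [nonnegCheck, forceNat_eq, Bool.and_eq_true, Nat.beq_eq] at h
  obtain ⟨h1, h2⟩ := h
  constructor
  · intro i hi
    have hh := congrArg (fun n => Nat.testBit n (k * i + (k - 1))) h1
    have e1 := sum_alternating hT (2 ^ (k - 1)) (2 ^ (k - 1)) (6 * m + 1)
    have e2 := sum_alternating hT (2 ^ (k - 1)) 0 (6 * m + 1)
    rw [zero_mul, add_zero] at e2
    rw [show 2 * (6 * m + 1) + 1 = 12 * m + 3 by ring] at e1 e2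
    change ((_ : ℕ) &&& _).testBit _ = _ at hh
    rw [Nat.testBit_and, testBit_code hk hf hV hi, ← e1, ← e2,
      testBit_digit_sum hk _ (fun i => if i % 2 = 0 then 2 ^ (k - 1) else 2 ^ (k - 1)) i
        (fun i => by simp [hk2]) hi,
      testBit_digit_sum hk _ (fun i => if i % 2 = 0 then 2 ^ (k - 1) else 0) i
        (fun i => by split_ifs <;> omega) hi] at hh
    by_cases hp : i % 2 = 0
    · simpa [hp] using hh
    · simpa [hp] using hh
  · intro i hi
    have hh := congrArg (fun n => Nat.testBit n (k * i + (k - 1))) h2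
    change ((_ : ℕ) &&& _).testBit _ = _ at hh
    rw [Nat.testBit_and, testBit_shadow hk hg hU hi, ← sum_constant hT,
      testBit_digit_sum hk _ (fun _ => 2 ^ (k - 1)) i (fun _ => hk2) hi] at hh
    simpa using hh

theorem negCheck_sound {m k V i : ℕ} (hk : 1 ≤ k) {f : ℕ → ℤ} (hf : ∀ i, |f i| < 2 ^ (k - 1))
    (hV : ∑ i ∈ Finset.range (12 * m + 3), (-1) ^ i * f i * ((2 ^ k : ℕ) : ℤ) ^ i = V)
    (hi : i < 12 * m + 3) (hi2 : i % 2 = 0) (h : negCheck m k i (2 ^ k) V = true) : f i < 0 := by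
  simp only [negCheck, forceNat_eq, Nat.beq_eq] at h
  have hh := congrArg (fun n => Nat.testBit n (k * i + (k - 1))) h
  change ((_ : ℕ) &&& _).testBit _ = _ at hh
  rw [Nat.testBit_and, testBit_code hk hf hV hi, if_pos hi2, Nat.testBit_two_pow_self] at hh
  simpa using hh

/-! ### Generation of the coefficient lists and the finite computation. -/

/-- The next term of the three-term recurrence in `j` for the numbers `(-1) ^ j * c_j`, where
`c_j` is the coefficient of `f ^ j` in the expansion of `(1 + t) ^ (-N)` in powers of
`f = t (1 - t) ^ 2 / (1 + t) ^ 4`. -/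
def nextCodeTerm (N j a b : ℕ) : ℕ :=
  (2 * ((N - 4 * j) * (N - 4 * j - 1) * (N - 4 * j - 2) * (N - 4 * j - 3)) * a
    - ((61 * N + 2 * N ^ 3 + 177 * j * N + 2 * j * N ^ 3 + 180 * j ^ 2 * N + 64 * j ^ 3 * N)
      - (78 + 15 * N ^ 2 + 284 * j + 27 * j * N ^ 2 + 398 * j ^ 2 + 12 * j ^ 2 * N ^ 2
        + 256 * j ^ 3 + 64 * j ^ 4)) * b) / ((j + 1) * (j + 2) * (2 * j + 3) * (N - 2 - j))

/-- No correctness of the recurrences, their truncated subtractions or their divisions is needed: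
`enumeratorCheck` certifies the resulting lists. -/
def codeTerms (N : ℕ) : ℕ → ℕ → ℕ → ℕ → List ℕ
  | 0, _, _, _ => []
  | f + 1, j, a, b => a :: forceNat (nextCodeTerm N j a b) fun c => codeTerms N f (j + 1) b c

/-- The coefficients of `(1 - u) ^ (-6 m)` in powers of `u / (1 - u) ^ 2`. -/
def shadowTerms (m : ℕ) : ℕ → ℕ → ℕ → List ℕ
  | 0, _, _ => []
  | f + 1, k, d => d :: forceNat
      (d * (6 * m - 2 * k) * (6 * m - 2 * k - 1) / ((6 * m - k - 1) * (k + 1)))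
      fun d' => shadowTerms m f (k + 1) d'

/-- The entries of the list times `s`, `s / 64`, `s / 64 ^ 2`, …, in reverse order. -/
def reverseDescale : ℕ → List ℕ → List ℕ → List ℕ
  | _, [], acc => acc
  | s, a :: l, acc => forceNat (a * s) fun b => reverseDescale (s / 64) l (b :: acc)

/-- The entries of the list times `s`, `64 * s`, `64 ^ 2 * s`, …. -/
def scaleUp : ℕ → List ℕ → List ℕ
  | _, [] => []
  | s, a :: l => forceNat (a * s) fun b => b :: scaleUp (s * 64) l

/-- W = 1 + O(t^(2m+1)) makes c_0, ..., c_{2m} the expansion coefficients of (1+t)^(-(12m+2)). The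
conditions on S give d_k for k < m, and |c_{3m-k}| = d_k 2^(6m-2-6k) supplies the rest. -/
def codeList (m : ℕ) : List ℕ :=
  codeTerms (12 * m + 2) (2 * m + 1) 0 1 (12 * m + 2) ++
    reverseDescale (2 ^ (6 * m - 2)) (shadowTerms m m 0 1) []

def shadowList (m : ℕ) : List ℕ :=
  shadowTerms m m 0 1 ++ scaleUp 4 (codeTerms (12 * m + 2) (2 * m + 1) 0 1 (12 * m + 2)).reverse

/-- Apply a test to the lists and values belonging to `m`. -/
def testEnumerator (m : ℕ) (p : ℕ → ℕ → ℕ → Bool) : Bool :=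
  forceNat (2 ^ (15 * m + 10)) fun T =>
  forceNat (codeValue (codeList m) (3 * m + 1) T) fun V =>
  forceNat (shadowValue (shadowList m) (3 * m + 1) T) fun U =>
  enumeratorCheck m (15 * m + 10) (codeList m) (shadowList m) T V U && p T V U

def hasNonnegEnumerator (m : ℕ) : Bool := testEnumerator m (nonnegCheck m (15 * m + 10))

def hasNegEnumerator (m : ℕ) : Bool :=
  testEnumerator m fun T V _ => negCheck m (15 * m + 10) (2 * m + 4) T V

set_option maxHeartbeats 0 in
theorem hasNonnegEnumerator_of_le : ∀ m, 1 ≤ m → m ≤ 155 → hasNonnegEnumerator m = true := by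
  intro m h1 h2
  interval_cases m <;> decide +kernel

set_option maxHeartbeats 0 in
theorem hasNegEnumerator_of_lt : ∀ m, 156 ≤ m → m < 175 → hasNegEnumerator m = true := by
  intro m h1 h2
  interval_cases m <;> decide +kernel

/-! ### Assembly of the theorem. -/

theorem IsEnumeratorSeq.isEnumeratorPair {m : ℕ} {c : ℕ → ℚ} (h : IsEnumeratorSeq m c) :
    IsEnumeratorPair m (expand ℚ 2 (codePoly m c))
      (X ^ 2 * expand ℚ 4 (shadowPoly m (shadowCoeff m c))) :=
  (isEnumeratorPair_iff m _ _).2 ⟨c, rfl, rfl, h⟩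

theorem hasNonnegIntCoeffs_expand {k : ℕ} (hk : 0 < k) {f : ℤ[X]} (hf : ∀ i, 0 ≤ f.coeff i) :
    HasNonnegIntCoeffs (expand ℚ k (f.map (Int.castRingHom ℚ))) := by
  intro i
  rw [coeff_expand hk]
  split_ifs with h
  · refine ⟨(f.coeff (i / k)).toNat, ?_⟩
    rw [coeff_map, eq_intCast, ← Int.cast_natCast, Int.toNat_of_nonneg (hf _)]
  · exact ⟨0, by simp⟩

theorem HasNonnegIntCoeffs.X_pow_mul {P : ℚ[X]} (h : HasNonnegIntCoeffs P) (d : ℕ) :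
    HasNonnegIntCoeffs (X ^ d * P) := by
  intro i
  rw [coeff_X_pow_mul']
  split_ifs
  · exact h _
  · exact ⟨0, by simp⟩

theorem HasNonnegIntCoeffs.nonneg {P : ℚ[X]} (h : HasNonnegIntCoeffs P) (i : ℕ) :
    0 ≤ P.coeff i := by
  obtain ⟨k, hk⟩ := h i
  rw [hk]; positivity

theorem coeff_nonneg_of_lt {f : ℤ[X]} {N : ℕ} (hN : f.natDegree < N)
    (h : ∀ i < N, 0 ≤ f.coeff i) (i : ℕ) : 0 ≤ f.coeff i := by
  rcases lt_or_ge i N with hi | hi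
  · exact h i hi
  · exact (coeff_eq_zero_of_natDegree_lt (hN.trans_le hi)).ge

theorem length_eq_of_enumeratorCheck {m k T V U : ℕ} {E D : List ℕ}
    (h : enumeratorCheck m k E D T V U = true) :
    E.length = 3 * m + 1 ∧ D.length = 3 * m + 1 := by
  simp only [enumeratorCheck, Bool.and_eq_true, Nat.beq_eq] at h
  have := (scaledEq_iff _ _ _ _ h.2.1).1
  rw [List.length_reverse] at this
  exact ⟨h.1, by rw [← this, h.1]⟩

theorem exists_nonneg_pair {m : ℕ} (hm : 1 ≤ m) (h : hasNonnegEnumerator m = true) :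
    ∃ W S, IsEnumeratorPair m W S ∧ HasNonnegIntCoeffs W ∧ HasNonnegIntCoeffs S := by
  simp only [hasNonnegEnumerator, testEnumerator, forceNat_eq, Bool.and_eq_true] at h
  obtain ⟨h1, h2⟩ := h
  have hk : 1 ≤ 15 * m + 10 := by omega
  obtain ⟨hseq, e1, e2, b1, b2, s1, s2⟩ := enumeratorCheck_sound hm hk h1
  obtain ⟨p1, p2⟩ := nonnegCheck_sound hk b1 b2 s1 s2 h2
  obtain ⟨l1, l2⟩ := length_eq_of_enumeratorCheck h1
  refine ⟨_, _, hseq.isEnumeratorPair, ?_, ?_⟩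
  · rw [e1]
    exact hasNonnegIntCoeffs_expand (by norm_num) (coeff_nonneg_of_lt (natDegree_codeInt_lt l1) p1)
  · rw [e2]
    exact (hasNonnegIntCoeffs_expand (by norm_num)
      (coeff_nonneg_of_lt (natDegree_shadowInt_lt l2) p2)).X_pow_mul 2

theorem exists_neg_pair {m : ℕ} (hm : 1 ≤ m) (h : hasNegEnumerator m = true) :
    ∃ W S, IsEnumeratorPair m W S ∧ W.coeff (2 * (2 * m + 4)) < 0 := by
  simp only [hasNegEnumerator, testEnumerator, forceNat_eq, Bool.and_eq_true] at h
  obtain ⟨h1, h2⟩ := h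
  have hk : 1 ≤ 15 * m + 10 := by omega
  obtain ⟨hseq, e1, -, b1, -, s1, -⟩ := enumeratorCheck_sound hm hk h1
  have := negCheck_sound hk b1 s1 (by omega) (by omega) h2
  refine ⟨_, _, hseq.isEnumeratorPair, ?_⟩
  rw [coeff_expand_two_mul, e1, coeff_map, eq_intCast]
  exact_mod_cast this

/-- Uniqueness transfers the computed negative a_{2m+4} to the given pair when m < 175; beyond that
b_{m+1} is negative. -/
theorem not_nonneg_of_isEnumeratorPair {m : ℕ} (hm : 156 ≤ m) {W S : ℚ[X]}
    (h : IsEnumeratorPair m W S) : ¬ (HasNonnegIntCoeffs W ∧ HasNonnegIntCoeffs S) := by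
  rintro ⟨hW, hS⟩
  rcases lt_or_ge m 175 with hlt | hge
  · obtain ⟨W', S', h', hneg⟩ := exists_neg_pair (by omega) (hasNegEnumerator_of_lt m hm hlt)
    obtain ⟨rfl, rfl⟩ := isEnumeratorPair_unique h h'
    exact (hW.nonneg _).not_gt hneg
  · obtain ⟨p, rfl⟩ : ∃ p, m = p + 5 := ⟨m - 5, by omega⟩
    obtain ⟨c, -, rfl, hc⟩ := (isEnumeratorPair_iff _ _ _).1 h
    have := hS.nonneg (4 * (p + 6) + 2)
    rw [coeff_shadow_expand] at this
    exact this.not_gt (hc.shadowPoly_coeff_neg (by omega))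

theorem mainTheorem2 :
    (∀ m : ℕ, 1 ≤ m →
      ∃ W S : Polynomial ℚ,
        (IsEnumeratorPair m W S ∧
          ∀ W' S' : Polynomial ℚ, IsEnumeratorPair m W' S' → W' = W ∧ S' = S) ∧
        (∀ C : Submodule (ZMod 2) (Fin (24 * m + 4) → ZMod 2), IsMinimalShadowCode m C →
          weightEnumerator (C : Set (Fin (24 * m + 4) → ZMod 2)) = W ∧
          weightEnumerator (shadow C) = S) ∧
        ((HasNonnegIntCoeffs W ∧ HasNonnegIntCoeffs S) ↔ m ≤ 155)) ∧
    (∀ m : ℕ, 156 ≤ m →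
      ¬ ∃ C : Submodule (ZMod 2) (Fin (24 * m + 4) → ZMod 2), IsMinimalShadowCode m C) := by
  refine ⟨fun m hm => ?_, ?_⟩
  · obtain ⟨c, hc⟩ := exists_isEnumeratorSeq hm
    have hpair := hc.isEnumeratorPair
    refine ⟨_, _, ⟨hpair, fun W' S' h' => isEnumeratorPair_unique hpair h'⟩,
      fun C hC => isEnumeratorPair_unique hpair (hC.isEnumeratorPair hm), ?_, fun h => ?_⟩
    · intro h
      by_contra hlt
      exact not_nonneg_of_isEnumeratorPair (by omega) hpair h
    · obtain ⟨W, S, h', hW, hS⟩ := exists_nonneg_pair hm (hasNonnegEnumerator_of_le m hm h)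
      obtain ⟨rfl, rfl⟩ := isEnumeratorPair_unique hpair h'
      exact ⟨hW, hS⟩
  · rintro m hm ⟨C, hC⟩
    exact not_nonneg_of_isEnumeratorPair hm (hC.isEnumeratorPair (by omega))
      ⟨hasNonnegIntCoeffs_weightEnumerator _, hasNonnegIntCoeffs_weightEnumerator _⟩
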